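/- **Setting.** Let $0\le r\le n$ and $I_r=\{1,\dots,r\}$; let $T^*\mathbb R^n$ have coordinates $(q,p)$ and the symplectic form $\sum_j dq_j\wedge dp_j$, and let $\pi(q,p)=q$. For $\sigma\subset I_r$ put $$L^0_\sigma=\{(q,p): q_\sigma=p_{I_r-\sigma}=q_{r+1}=\dots=q_n=0,\ q_{I_r-\sigma}\ge 0\},\qquad \mathbb L=\bigcup_{\sigma\subset I_r}L^0_\sigma .$$ A *reticular Lagrangian map* is a map germ $\pi\circ i:(\mathbb L,0)\to(T^*\mathbb R^n,0)\to(\mathbb R^n,0)$, where $i$ is the restriction to $\mathbb L$ of a symplectic diffeomorphism germ on $(T^*\mathbb R^n,0)$. Let $C_\sigma$ be the set of critical values of $\pi\circ i|_{L^0_\sigma}$ and $Q_{\sigma,\tau}=\pi\circ i(L^0_\sigma\cap L^0_\tau)$ for $\sigma\ne\tau$. Two reticular Lagrangian maps $\pi\circ i_1,\pi\circ i_2$ are *caustic-equivalent* if there is a diffeomorphism germ $g$ on $(\mathbb R^n,0)$ with $$g(C^1_\sigma)=C^2_\sigma,\qquad g(Q^1_{\sigma,\tau})=Q^2_{\sigma,\tau}\qquad\text{for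 all }\sigma,\tau\subset I_r,\ \sigma\neq\tau,$$ as set germs at $0$. (Since the image of a map germ need not be a well-defined set germ, this is understood as follows: for every neighbourhood $W$ of $0$ in $T^*\mathbb R^n$ there is a neighbourhood $W_0$ of $0$ such that for every neighbourhood $W_1\subset W_0$ of $0$ there is a neighbourhood $W_2\subset W$ of $0$ for which all the equalities hold as set germs at $0$ for the representatives of $\pi\circ i_1$ on $\mathbb L\cap W_1$ and of $\pi\circ i_2$ on $\mathbb L\cap W_2$, and the same with the roles of $W_1$ and $W_2$ exchanged.) Let $\mathbb H^r=\{x\in\mathbb R^r:x_1,\dots,x_r\ge 0\}$. Let $\mathcal E(r;k+n)$ be the ring of germs at $0$ of smooth functions of $(x,y,q)\in\mathbb H^r\times\mathbb R^k\times\mathbb R^n$, let $\mathfrak M(r;k+n)$ be its maximal ideal, and let $\mathcal E(n)$ be the ring of germs at $0$ of smooth functions on $\mathbb R^n$. A germ $F\in\mathfrak M(r;k+n)^2$ is a *generating family* of $\pi\circ i$ if the differentials at $0$ of $x_1,\dots,x_r,\frac{\partial F}{\partial x_1},\dots,\frac{\partial F}{\partial x_r},\frac{\partial F}{\partial y_1},\dots,\frac{\partial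 F}{\partial y_k}$ are linearly independent and, for every $\sigma\subset I_r$, as set germs at $0$, $$i(L^0_\sigma)=\Big\{\Big(q,\frac{\partial F}{\partial q}(x,y,q)\Big): x_\sigma=\frac{\partial F}{\partial x_{I_r-\sigma}}=\frac{\partial F}{\partial y}=0,\ x_{I_r-\sigma}\ge 0\Big\}.$$ Two germs $F,G\in\mathcal E(r;k+n)$ are *reticular $\mathcal P$-$\mathcal C$-equivalent* if $G=a\cdot F\circ\Phi+b$ for some $b\in\mathcal E(n)$, some $a\in\mathcal E(n)$ with $a(0)\ne0$, and some diffeomorphism germ $\Phi$ on $(\mathbb H^r\times\mathbb R^{k+n},0)$ of the form $\Phi(x,y,q)=(x_1\phi_1(x,y,q),\dots,x_r\phi_r(x,y,q),\phi'(x,y,q),\phi''(q))$. Germs $F\in\mathcal E(r;k_1+n)$ and $G\in\mathcal E(r;k_2+n)$ are *stably reticular $\mathcal P$-$\mathcal C$-equivalent* if they become reticular $\mathcal P$-$\mathcal C$-equivalent after adding to each a non-degenerate quadratic form in (finitely many, possibly zero) new variables of type $y$. **Proposition.** Let $\pi\circ i_1$ and $\pi\circ i_2$ be reticular Lagrangian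 maps (with the same $r$ and $n$) with generating families $F_1\in\mathfrak M(r;k_1+n)^2$ and $F_2\in\mathfrak M(r;k_2+n)^2$. If $F_1$ and $F_2$ are stably reticular $\mathcal P$-$\mathcal C$-equivalent, then $\pi\circ i_1$ and $\pi\circ i_2$ are caustic-equivalent. -/

import Mathlib

open Set Filter Topology
open scoped ContDiff

/-- A (representative of a) diffeomorphism germ `(E, 0) → (F, 0)`. -/
structure DiffeoGerm (E F : Type) [NormedAddCommGroup E] [NormedSpace ℝ E]
    [NormedAddCommGroup F] [NormedSpace ℝ F] where
  toHomeo : OpenPartialHomeomorph E F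
  zero_mem : (0 : E) ∈ toHomeo.source
  map_zero : toHomeo 0 = 0
  smooth : ContDiffOn ℝ ∞ toHomeo toHomeo.source
  smooth_symm : ContDiffOn ℝ ∞ toHomeo.symm toHomeo.target

/-- `f` is (a representative of) a smooth germ at `0`: it is `C^∞` on a neighbourhood of `0`. -/
def SmoothGerm {E F : Type} [NormedAddCommGroup E] [NormedSpace ℝ E]
    [NormedAddCommGroup F] [NormedSpace ℝ F] (f : E → F) : Prop :=
  ∃ U ∈ 𝓝 (0 : E), ContDiffOn ℝ ∞ f U

/-! ### Reticular Lagrangian maps and their caustics -/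

/-- The cotangent bundle `T^*ℝⁿ`, with points `(q, p)`. -/
abbrev Cotangent (n : ℕ) : Type := (Fin n → ℝ) × (Fin n → ℝ)

/-- The canonical symplectic form `∑ dq_j ∧ dp_j` on `T^*ℝⁿ`. -/
def canonicalForm {n : ℕ} (u v : Cotangent n) : ℝ :=
  ∑ j, (u.1 j * v.2 j - u.2 j * v.1 j)

/-- A (representative of a) symplectic diffeomorphism germ on `(T^*ℝⁿ, 0)`. -/
structure SymplecticGerm (n : ℕ) extends DiffeoGerm (Cotangent n) (Cotangent n) where
  symplectic : ∀ z ∈ toHomeo.source, ∀ u v : Cotangent n,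
    canonicalForm (fderiv ℝ toHomeo z u) (fderiv ℝ toHomeo z v) = canonicalForm u v

/-- The linear space `{q_σ = 0, p_{I_r - σ} = 0, q_{r+1} = ⋯ = q_n = 0}`, which is the tangent
space of `L_σ⁰` at each of its points. -/
def tangentL {r n : ℕ} (hrn : r ≤ n) (σ : Finset (Fin r)) : Set (Cotangent n) :=
  {z | (∀ i ∈ σ, z.1 (Fin.castLE hrn i) = 0) ∧ (∀ i ∉ σ, z.2 (Fin.castLE hrn i) = 0) ∧
    ∀ j : Fin n, r ≤ (j : ℕ) → z.1 j = 0}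

/-- `L_σ⁰ = {q_σ = p_{I_r - σ} = q_{r+1} = ⋯ = q_n = 0, q_{I_r - σ} ≥ 0}`. -/
def stdL {r n : ℕ} (hrn : r ≤ n) (σ : Finset (Fin r)) : Set (Cotangent n) :=
  {z | z ∈ tangentL hrn σ ∧ ∀ i ∉ σ, 0 ≤ z.1 (Fin.castLE hrn i)}

/- A reticular Lagrangian map is `π ∘ i` with `i` the restriction of a symplectic diffeomorphism
germ `S` to `𝕃 = ⋃_σ L_σ⁰`. It is presented by an extension `S` of `i`; everything below
depends on the restriction of `S` to `𝕃` only. -/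

/-- The critical points in `W` of the Lagrangian map `π ∘ i|_{L_σ⁰}`: the differential, on the
`n`-dimensional tangent space of `L_σ⁰`, has a nonzero kernel (equivalently, rank `< n`). -/
def critPoints {r n : ℕ} (hrn : r ≤ n) (S : SymplecticGerm n) (σ : Finset (Fin r))
    (W : Set (Cotangent n)) : Set (Cotangent n) :=
  {z | z ∈ stdL hrn σ ∩ W ∩ S.toHomeo.source ∧
    ∃ v ∈ tangentL hrn σ, v ≠ 0 ∧ (fderiv ℝ S.toHomeo z v).1 = 0}

/-- The caustic `C_σ` (set of critical values of `π ∘ i|_{L_σ⁰}`), for the representative of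
`π ∘ i` on `𝕃 ∩ W`. -/
def caustic {r n : ℕ} (hrn : r ≤ n) (S : SymplecticGerm n) (σ : Finset (Fin r))
    (W : Set (Cotangent n)) : Set (Fin n → ℝ) :=
  (fun z => (S.toHomeo z).1) '' critPoints hrn S σ W

/-- The quasi-caustic `Q_{σ,τ} = π ∘ i (L_σ⁰ ∩ L_τ⁰)`, for the representative of `π ∘ i`
on `𝕃 ∩ W`. -/
def quasiCaustic {r n : ℕ} (hrn : r ≤ n) (S : SymplecticGerm n) (σ τ : Finset (Fin r))
    (W : Set (Cotangent n)) : Set (Fin n → ℝ) :=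
  (fun z => (S.toHomeo z).1) '' (stdL hrn σ ∩ stdL hrn τ ∩ W ∩ S.toHomeo.source)

/-- For the representatives on `W₁` and `W₂`, one has, as set germs at `0`,
`g(C¹_σ) = C²_σ` and `g(Q¹_{σ,τ}) = Q²_{σ,τ}` for all `σ ≠ τ`. -/
def MapsCaustics {r n : ℕ} (hrn : r ≤ n) (S₁ S₂ : SymplecticGerm n)
    (g : DiffeoGerm (Fin n → ℝ) (Fin n → ℝ)) (W₁ W₂ : Set (Cotangent n)) : Prop :=
  (∀ σ : Finset (Fin r),
    (g.toHomeo '' caustic hrn S₁ σ W₁ : Set (Fin n → ℝ)) =ᶠ[𝓝 0] caustic hrn S₂ σ W₂) ∧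
  ∀ σ τ : Finset (Fin r), σ ≠ τ →
    (g.toHomeo '' quasiCaustic hrn S₁ σ τ W₁ : Set (Fin n → ℝ)) =ᶠ[𝓝 0]
      quasiCaustic hrn S₂ σ τ W₂

/-- Caustic-equivalence: there is a diffeomorphism germ `g` on `(ℝⁿ, 0)` that maps every `C¹_σ`
to `C²_σ` and every `Q¹_{σ,τ}` to `Q²_{σ,τ}`.
The image of a map germ need not be a well-defined set germ (consider `(u, v) ↦ (u, u v)`), so the
equalities are required between representatives: each sufficiently small representative on either
side corresponds to an arbitrarily small one on the other side. Where the germs of the images do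
not depend on the (small) representatives, this is equality of set germs. -/
def CausticEquivalent {r n : ℕ} (hrn : r ≤ n) (S₁ S₂ : SymplecticGerm n) : Prop :=
  ∃ g : DiffeoGerm (Fin n → ℝ) (Fin n → ℝ),
    ∀ W ∈ 𝓝 (0 : Cotangent n), ∃ W₀ ∈ 𝓝 (0 : Cotangent n),
      (∀ W₁ ∈ 𝓝 (0 : Cotangent n), W₁ ⊆ W₀ →
        ∃ W₂ ∈ 𝓝 (0 : Cotangent n), W₂ ⊆ W ∧ MapsCaustics hrn S₁ S₂ g W₁ W₂) ∧
      (∀ W₂ ∈ 𝓝 (0 : Cotangent n), W₂ ⊆ W₀ →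
        ∃ W₁ ∈ 𝓝 (0 : Cotangent n), W₁ ⊆ W ∧ MapsCaustics hrn S₁ S₂ g W₁ W₂)

/-! ### Generating families -/

/-- The space `ℝ^r × ℝ^k × ℝ^n` of `(x, y, q)`. -/
abbrev XYQ (r k n : ℕ) : Type := (Fin r → ℝ) × (Fin k → ℝ) × (Fin n → ℝ)

/-- `ℍ^r × ℝ^{k+n}`, where `ℍ^r = {x ∈ ℝ^r | x_1 ≥ 0, …, x_r ≥ 0}`. -/
def corner (r k n : ℕ) : Set (XYQ r k n) := {z | ∀ i, 0 ≤ z.1 i}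

/- A function germ on `(ℍ^r × ℝ^{k+n}, 0)` is given by a smooth extension to a neighbourhood of `0`
in `ℝ^{r+k+n}`. Derivatives at points of the corner do not depend on the extension. -/

/-- `∂F/∂x_i`. -/
noncomputable def dX {r k n : ℕ} (F : XYQ r k n → ℝ) (i : Fin r) (z : XYQ r k n) : ℝ :=
  fderiv ℝ F z (Pi.single i 1, 0, 0)

/-- `∂F/∂y_j`. -/
noncomputable def dY {r k n : ℕ} (F : XYQ r k n → ℝ) (j : Fin k) (z : XYQ r k n) : ℝ :=
  fderiv ℝ F z (0, Pi.single j 1, 0)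

/-- `∂F/∂q = (∂F/∂q_1, …, ∂F/∂q_n)`. -/
noncomputable def dQ {r k n : ℕ} (F : XYQ r k n → ℝ) (z : XYQ r k n) : Fin n → ℝ :=
  fun l => fderiv ℝ F z (0, 0, Pi.single l 1)

/-- `F` is `S`-non-degenerate: the functions `x_i`, `∂F/∂x_i`, `∂F/∂y_j` are independent at `0`,
that is, their differentials at `0` are linearly independent. -/
def SNondegenerate {r k n : ℕ} (F : XYQ r k n → ℝ) : Prop :=
  LinearIndependent ℝ (Sum.elim (fun i : Fin r => fderiv ℝ (fun z : XYQ r k n => z.1 i) 0)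
    (Sum.elim (fun i : Fin r => fderiv ℝ (dX F i) 0) (fun j : Fin k => fderiv ℝ (dY F j) 0)))

/-- The points of the corner with `x_σ = 0`, `∂F/∂x_{I_r - σ} = 0` and `∂F/∂y = 0`. -/
def fiberCritical {r k n : ℕ} (F : XYQ r k n → ℝ) (σ : Finset (Fin r)) : Set (XYQ r k n) :=
  {z | z ∈ corner r k n ∧ (∀ i ∈ σ, z.1 i = 0) ∧ (∀ i ∉ σ, dX F i z = 0) ∧ ∀ j, dY F j z = 0}

/-- `F` is a generating family of the reticular Lagrangian map `π ∘ S|_𝕃`: it is an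
`S`-non-degenerate element of `𝔐(r; k+n)²` and, as set germs at `0`,
`i(L_σ⁰) = {(q, ∂F/∂q) | x_σ = ∂F/∂x_{I_r - σ} = ∂F/∂y = 0, x_{I_r - σ} ≥ 0}` for all `σ`. -/
def IsGeneratingFamily {r k n : ℕ} (hrn : r ≤ n) (S : SymplecticGerm n)
    (F : XYQ r k n → ℝ) : Prop :=
  SmoothGerm F ∧ F 0 = 0 ∧ fderiv ℝ F 0 = 0 ∧ SNondegenerate F ∧
  ∃ U ∈ 𝓝 (0 : XYQ r k n), ∀ W ∈ 𝓝 (0 : XYQ r k n), W ⊆ U → ∀ σ : Finset (Fin r),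
    (S.toHomeo '' (stdL hrn σ ∩ S.toHomeo.source) : Set (Cotangent n)) =ᶠ[𝓝 0]
      ((fun z : XYQ r k n => ((z.2.2, dQ F z) : Cotangent n)) '' (fiberCritical F σ ∩ W) :
        Set (Cotangent n))

/-! ### Stable reticular `𝒫`-`𝒞`-equivalence -/

/-- `Φ ∈ ℬ_n(r; k+n)`: `Φ` is a diffeomorphism germ that preserves the corner and has the form
`Φ(x, y, q) = (x_1 φ_1(x, y, q), …, x_r φ_r(x, y, q), φ'(x, y, q), φ''(q))`. (The numbers `k`, `k'`
of variables `y` in source and target agree as soon as such a `Φ` exists.) -/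
def IsReticularDiffeo {r k k' n : ℕ} (Φ : DiffeoGerm (XYQ r k n) (XYQ r k' n)) : Prop :=
  (∀ z ∈ Φ.toHomeo.source, z ∈ corner r k n ↔ Φ.toHomeo z ∈ corner r k' n) ∧
  (∃ φ : XYQ r k n → Fin r → ℝ, ContDiffOn ℝ ∞ φ Φ.toHomeo.source ∧
    ∀ z ∈ Φ.toHomeo.source, ∀ i, (Φ.toHomeo z).1 i = z.1 i * φ z i) ∧
  ∃ ψ : (Fin n → ℝ) → (Fin n → ℝ), ∀ z ∈ Φ.toHomeo.source, (Φ.toHomeo z).2.2 = ψ z.2.2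

/-- Reticular `𝒫`-`𝒞`-equivalence: `G = a · F ∘ Φ + b` on `(ℍ^r × ℝ^{k+n}, 0)` with
`Φ ∈ ℬ_n(r; k+n)`, a unit `a ∈ ℰ(n)` and `b ∈ ℰ(n)`. -/
def PCEquivalent {r k k' n : ℕ} (F : XYQ r k n → ℝ) (G : XYQ r k' n → ℝ) : Prop :=
  ∃ (Φ : DiffeoGerm (XYQ r k' n) (XYQ r k n)) (a b : (Fin n → ℝ) → ℝ),
    IsReticularDiffeo Φ ∧ SmoothGerm a ∧ a 0 ≠ 0 ∧ SmoothGerm b ∧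
    ∀ᶠ z in 𝓝[corner r k' n] 0, G z = a z.2.2 * F (Φ.toHomeo z) + b z.2.2

/-- `F(x, y, q) + Q(y')` with `l` new variables `y'`. -/
def addQuadratic {r k l n : ℕ} (F : XYQ r k n → ℝ) (Q : QuadraticForm ℝ (Fin l → ℝ)) :
    XYQ r (k + l) n → ℝ :=
  fun z => F (z.1, fun j => z.2.1 (Fin.castAdd l j), z.2.2) + Q (fun j => z.2.1 (Fin.natAdd k j))

/-- Stable reticular `𝒫`-`𝒞`-equivalence: `F` and `G` become reticular `𝒫`-`𝒞`-equivalent after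
adding non-degenerate quadratic forms in new variables of type `y`. -/
def StablyPCEquivalent {r k k' n : ℕ} (F : XYQ r k n → ℝ) (G : XYQ r k' n → ℝ) : Prop :=
  ∃ (l l' : ℕ) (Q : QuadraticForm ℝ (Fin l → ℝ)) (Q' : QuadraticForm ℝ (Fin l' → ℝ)),
    (QuadraticMap.polarBilin Q).Nondegenerate ∧ (QuadraticMap.polarBilin Q').Nondegenerate ∧
    PCEquivalent (addQuadratic F Q) (addQuadratic G Q')

/- A reticular Lagrangian map and the projection to the parameters `q` of the fiberwise critical
points of a generating family `F` are instances of one structure: a germ of a map to `ℝⁿ`, with a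
stratum for each `σ` (`L_σ⁰`, respectively the critical points with `x_σ = 0`) and a set of singular
points in each stratum. An isomorphism of two such structures over a diffeomorphism germ of `ℝⁿ`
carries caustics to caustics and quasi-caustics to quasi-caustics, for matching representatives.

* If `F` is a generating family of `π ∘ i`, then `(x, y, q) ↦ (q, ∂F/∂q)` identifies the critical
  points of `F` with `i(𝕃)`. Critical values correspond to points where the Hessian of `F` in the
  variables `x_{I_r - σ}`, `y` is degenerate: the tangent spaces of the critical points have
  isotropic images, while `di(T L_σ⁰)` is Lagrangian, so that the two coincide.
* A non-degenerate quadratic form in new variables adds the equation that these vanish and a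
  non-degenerate block to the Hessian.
* If `G = a · F ∘ Φ + b` with `a`, `b` and the last component of `Φ` functions of `q` only, then
  along the fibers the critical points correspond under `Φ`, and there the Hessian of `G` is the
  pullback of that of `F` multiplied by `a ≠ 0`. The last component of `Φ` is the diffeomorphism
  of the base.
-/

/-! ### Marked germs and caustics -/

/-- A germ of a map `proj : X → Q` along `filter`, together with a family of set germs `mark i` of
its source. -/
structure MarkedGerm (ι X Q : Type*) where
  filter : Filter X
  mark : ι → Set X
  proj : X → Q

namespace MarkedGerm

variable {ι X Y Z Q Q' Q'' : Type*}

/-- The marked germ with the marks `P i` and `P i ∩ D i`. For `P` the strata of a map and `D` its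
singular points, the projections of the former give the quasi-caustics and those of the latter the
caustics. -/
def ofStrata (l : Filter X) (P D : ι → Set X) (p : X → Q) : MarkedGerm (ι ⊕ ι) X Q where
  filter := l
  mark := Sum.elim P fun i => P i ∩ D i
  proj := p

/-- The set of common values of the marks `i` and `j`, for the representative on `W`. -/
def values (M : MarkedGerm ι X Q) (i j : ι) (W : Set X) : Set Q :=
  M.proj '' (M.mark i ∩ M.mark j ∩ W)

/-- `A` and `B` are germs of maps that restrict to mutually inverse bijections between
corresponding marks and lift `h` along the projections. -/
structure IsIsoOver (M : MarkedGerm ι X Q) (M' : MarkedGerm ι Y Q') (h : Q → Q') (A : X → Y)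
    (B : Y → X) : Prop where
  tendsto : Tendsto A M.filter M'.filter
  tendsto_inv : Tendsto B M'.filter M.filter
  forward : ∀ᶠ x in M.filter, ∀ i, x ∈ M.mark i →
    A x ∈ M'.mark i ∧ B (A x) = x ∧ M'.proj (A x) = h (M.proj x)
  backward : ∀ᶠ y in M'.filter, ∀ i, y ∈ M'.mark i → B y ∈ M.mark i ∧ A (B y) = y

/-- Isomorphism of marked germs over the map `h` of the bases. -/
def EquivOver (M : MarkedGerm ι X Q) (M' : MarkedGerm ι Y Q') (h : Q → Q') : Prop :=
  ∃ A B, M.IsIsoOver M' h A B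

variable {M : MarkedGerm ι X Q} {M' : MarkedGerm ι Y Q'} {M'' : MarkedGerm ι Z Q''}
  {h : Q → Q'} {h' : Q' → Q''}

theorem EquivOver.trans (H : M.EquivOver M' h) (H' : M'.EquivOver M'' h') :
    M.EquivOver M'' (h' ∘ h) := by
  obtain ⟨A, B, H⟩ := H
  obtain ⟨A', B', H'⟩ := H'
  refine ⟨A' ∘ A, B ∘ B', H'.tendsto.comp H.tendsto, H.tendsto_inv.comp H'.tendsto_inv, ?_, ?_⟩
  · filter_upwards [H.forward, H.tendsto.eventually H'.forward] with x hx hAx i hi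
    obtain ⟨hA, hBA, hproj⟩ := hx i hi
    obtain ⟨hA', hBA', hproj'⟩ := hAx i hA
    exact ⟨hA', by simp only [Function.comp_apply, hBA', hBA],
      by simp only [Function.comp_apply, hproj', hproj]⟩
  · filter_upwards [H'.backward, H'.tendsto_inv.eventually H.backward] with z hz hBz i hi
    obtain ⟨hB', hAB'⟩ := hz i hi
    obtain ⟨hB, hAB⟩ := hBz i hB'
    exact ⟨hB, by simp only [Function.comp_apply, hAB, hAB']⟩

theorem EquivOver.symm {g : Q' → Q} (H : M.EquivOver M' h)
    (hg : ∀ᶠ x in M.filter, g (h (M.proj x)) = M.proj x) : M'.EquivOver M g := by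
  obtain ⟨A, B, H⟩ := H
  refine ⟨B, A, H.tendsto_inv, H.tendsto, ?_, ?_⟩
  · filter_upwards [H.backward, H.tendsto_inv.eventually H.forward,
      H.tendsto_inv.eventually hg] with y hy hBy hgy i hi
    obtain ⟨hB, hAB⟩ := hy i hi
    have hproj := (hBy i hB).2.2
    rw [hAB] at hproj
    exact ⟨hB, hAB, by rw [hproj, hgy]⟩
  · filter_upwards [H.forward] with x hx i hi
    exact ⟨(hx i hi).1, (hx i hi).2.1⟩

theorem EquivOver.exists_values_eq (H : M.EquivOver M' h) {W : Set Y} (hW : W ∈ M'.filter) :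
    ∃ W₀ ∈ M.filter, ∀ W₁ ∈ M.filter, W₁ ⊆ W₀ →
      ∃ W₂ ∈ M'.filter, W₂ ⊆ W ∧ ∀ i j, h '' M.values i j W₁ = M'.values i j W₂ := by
  obtain ⟨A, B, H⟩ := H
  refine ⟨_, inter_mem H.forward (H.tendsto (inter_mem hW H.backward)), fun W₁ hW₁ hsub =>
    ⟨_, inter_mem (inter_mem hW H.backward) (H.tendsto_inv hW₁), fun y hy => hy.1.1,
      fun i j => ?_⟩⟩
  rw [values, image_image]
  refine Subset.antisymm ?_ ?_
  · rintro _ ⟨x, ⟨⟨hi, hj⟩, hx⟩, rfl⟩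
    obtain ⟨hfwd, hAx⟩ := hsub hx
    obtain ⟨hAi, hBA, hproj⟩ := hfwd i hi
    exact ⟨A x, ⟨⟨hAi, (hfwd j hj).1⟩, hAx, by rwa [mem_preimage, hBA]⟩, hproj⟩
  · rintro _ ⟨y, ⟨⟨hi, hj⟩, ⟨-, hbwd⟩, hBy⟩, rfl⟩
    obtain ⟨hBi, hAB⟩ := hbwd i hi
    have hproj := ((hsub hBy).1 i hBi).2.2
    rw [hAB] at hproj
    exact ⟨B y, ⟨⟨hBi, (hbwd j hj).1⟩, hBy⟩, hproj.symm⟩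

theorem EquivOver.exists_values_eq_symm {g : Q' → Q} (H : M'.EquivOver M g)
    (hg : ∀ᶠ y in M'.filter, h (g (M'.proj y)) = M'.proj y) {W : Set X} (hW : W ∈ M.filter) :
    ∃ W₀ ∈ M'.filter, ∀ W₂ ∈ M'.filter, W₂ ⊆ W₀ →
      ∃ W₁ ∈ M.filter, W₁ ⊆ W ∧ ∀ i j, h '' M.values i j W₁ = M'.values i j W₂ := by
  obtain ⟨W₀, hW₀, hvalues⟩ := H.exists_values_eq hW
  refine ⟨_, inter_mem hW₀ hg, fun W₂ hW₂ hsub => ?_⟩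
  obtain ⟨W₁, hW₁, hW₁W, heq⟩ := hvalues W₂ hW₂ fun y hy => (hsub hy).1
  refine ⟨W₁, hW₁, hW₁W, fun i j => ?_⟩
  rw [← heq, values, image_image, image_image]
  exact image_congr fun y hy => (hsub hy.2).2

theorem ofStrata_equivOver {l : Filter X} {l' : Filter Y} {P D : ι → Set X} {P' D' : ι → Set Y}
    {p : X → Q} {p' : Y → Q'} {A : X → Y} {B : Y → X} (hA : Tendsto A l l')
    (hB : Tendsto B l' l)
    (hforward : ∀ᶠ x in l, ∀ i, x ∈ P i → A x ∈ P' i ∧ B (A x) = x ∧ p' (A x) = h (p x))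
    (hbackward : ∀ᶠ y in l', ∀ i, y ∈ P' i → B y ∈ P i ∧ A (B y) = y)
    (hD : ∀ᶠ x in l, ∀ i, x ∈ P i → (x ∈ D i ↔ A x ∈ D' i)) :
    (ofStrata l P D p).EquivOver (ofStrata l' P' D' p') h := by
  refine ⟨A, B, hA, hB, ?_, ?_⟩
  · filter_upwards [hforward, hD] with x hx hDx
    rintro (i | i) hi
    · exact hx i hi
    · obtain ⟨hAx, hrest⟩ := hx i hi.1
      exact ⟨⟨hAx, (hDx i hi.1).1 hi.2⟩, hrest⟩
  · filter_upwards [hbackward, hB.eventually hD] with y hy hDy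
    rintro (i | i) hi
    · exact hy i hi
    · obtain ⟨hBy, hAB⟩ := hy i hi.1
      exact ⟨⟨hBy, (hDy i hBy).2 (by rw [hAB]; exact hi.2)⟩, hAB⟩

end MarkedGerm

section LeftInverse

variable {E F : Type*} [NormedAddCommGroup E] [NormedSpace ℝ E] [NormedAddCommGroup F]
  [NormedSpace ℝ F]

theorem fderiv_apply_fderiv_of_eventually_leftInverse {f : E → F} {g : F → E} {x : E}
    (hg : DifferentiableAt ℝ g (f x)) (hf : DifferentiableAt ℝ f x)
    (hgf : ∀ᶠ z in 𝓝 x, g (f z) = z) (v : E) : fderiv ℝ g (f x) (fderiv ℝ f x v) = v := by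
  have hid : fderiv ℝ (g ∘ f) x = ContinuousLinearMap.id ℝ E :=
    (EventuallyEq.fderiv_eq hgf).trans fderiv_id
  rw [fderiv_comp x hg hf] at hid
  exact DFunLike.congr_fun hid v

end LeftInverse

namespace DiffeoGerm

variable {E F : Type} [NormedAddCommGroup E] [NormedSpace ℝ E] [NormedAddCommGroup F]
  [NormedSpace ℝ F]

/-- The inverse of a diffeomorphism germ. -/
def symm (Φ : DiffeoGerm E F) : DiffeoGerm F E where
  toHomeo := Φ.toHomeo.symm
  zero_mem := by simpa [Φ.map_zero] using Φ.toHomeo.map_source Φ.zero_mem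
  map_zero := by simpa [Φ.map_zero] using Φ.toHomeo.left_inv Φ.zero_mem
  smooth := Φ.smooth_symm
  smooth_symm := Φ.smooth

theorem source_mem (Φ : DiffeoGerm E F) : Φ.toHomeo.source ∈ 𝓝 (0 : E) :=
  Φ.toHomeo.open_source.mem_nhds Φ.zero_mem

theorem tendsto (Φ : DiffeoGerm E F) : Tendsto Φ.toHomeo (𝓝 0) (𝓝 0) := by
  simpa only [ContinuousAt, Φ.map_zero] using Φ.toHomeo.continuousAt Φ.zero_mem

theorem eventually_symm_apply (Φ : DiffeoGerm E F) :
    ∀ᶠ z in 𝓝 (0 : E), Φ.symm.toHomeo (Φ.toHomeo z) = z :=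
  Φ.toHomeo.eventually_left_inverse Φ.zero_mem

theorem contDiffAt (Φ : DiffeoGerm E F) {z : E} (hz : z ∈ Φ.toHomeo.source) :
    ContDiffAt ℝ ∞ Φ.toHomeo z :=
  Φ.smooth.contDiffAt (Φ.toHomeo.open_source.mem_nhds hz)

theorem differentiableAt (Φ : DiffeoGerm E F) {z : E} (hz : z ∈ Φ.toHomeo.source) :
    DifferentiableAt ℝ Φ.toHomeo z :=
  (Φ.contDiffAt hz).differentiableAt (by simp)

theorem fderiv_symm_fderiv (Φ : DiffeoGerm E F) {z : E} (hz : z ∈ Φ.toHomeo.source) (v : E) :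
    fderiv ℝ Φ.symm.toHomeo (Φ.toHomeo z) (fderiv ℝ Φ.toHomeo z v) = v :=
  fderiv_apply_fderiv_of_eventually_leftInverse
    (Φ.symm.differentiableAt (Φ.toHomeo.map_source hz)) (Φ.differentiableAt hz)
    (Φ.toHomeo.eventually_left_inverse hz) v

/-- The differential of a diffeomorphism germ at a point of its source. -/
noncomputable def fderivEquiv (Φ : DiffeoGerm E F) {z : E} (hz : z ∈ Φ.toHomeo.source) :
    E ≃L[ℝ] F :=
  .equivOfInverse (fderiv ℝ Φ.toHomeo z) (fderiv ℝ Φ.symm.toHomeo (Φ.toHomeo z))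
    (Φ.fderiv_symm_fderiv hz) fun v => by
      simpa only [symm, OpenPartialHomeomorph.symm_symm, Φ.toHomeo.left_inv hz]
        using Φ.symm.fderiv_symm_fderiv (Φ.toHomeo.map_source hz) v

@[simp]
theorem coe_fderivEquiv (Φ : DiffeoGerm E F) {z : E} (hz : z ∈ Φ.toHomeo.source) :
    (Φ.fderivEquiv hz : E →L[ℝ] F) = fderiv ℝ Φ.toHomeo z :=
  rfl

end DiffeoGerm

section LagrangianGerm

variable {r n : ℕ} (hrn : r ≤ n)

/-- The points where the differential of `π ∘ f` has a nonzero kernel on the tangent space of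
`L_σ⁰`. -/
def singularPoints (f : Cotangent n → Cotangent n) (σ : Finset (Fin r)) : Set (Cotangent n) :=
  {z | ∃ v ∈ tangentL hrn σ, v ≠ 0 ∧ (fderiv ℝ f z v).1 = 0}

/-- The reticular Lagrangian map `π ∘ S|_𝕃`, with its strata `L_σ⁰` and their critical points as
marks. -/
def lagrangianGerm (S : SymplecticGerm n) :
    MarkedGerm (Finset (Fin r) ⊕ Finset (Fin r)) (Cotangent n) (Fin n → ℝ) :=
  .ofStrata (𝓝 0) (stdL hrn) (singularPoints hrn S.toHomeo) fun z => (S.toHomeo z).1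

variable {hrn}

theorem caustic_eq_values {S : SymplecticGerm n} {W : Set (Cotangent n)}
    (hW : W ⊆ S.toHomeo.source) (σ : Finset (Fin r)) :
    caustic hrn S σ W = (lagrangianGerm hrn S).values (.inr σ) (.inr σ) W := by
  refine congrArg (image _) (Set.ext fun z => ⟨?_, ?_⟩)
  · rintro ⟨⟨⟨hz, hzW⟩, -⟩, hsing⟩
    exact ⟨⟨⟨hz, hsing⟩, hz, hsing⟩, hzW⟩
  · rintro ⟨⟨⟨hz, hsing⟩, -⟩, hzW⟩
    exact ⟨⟨⟨hz, hzW⟩, hW hzW⟩, hsing⟩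

theorem quasiCaustic_eq_values {S : SymplecticGerm n} {W : Set (Cotangent n)}
    (hW : W ⊆ S.toHomeo.source) (σ τ : Finset (Fin r)) :
    quasiCaustic hrn S σ τ W = (lagrangianGerm hrn S).values (.inl σ) (.inl τ) W :=
  congrArg (image _) (inter_eq_left.2 (inter_subset_right.trans hW))

theorem MapsCaustics.of_values_eq {S₁ S₂ : SymplecticGerm n}
    {g : DiffeoGerm (Fin n → ℝ) (Fin n → ℝ)} {W₁ W₂ : Set (Cotangent n)}
    (hW₁ : W₁ ⊆ S₁.toHomeo.source) (hW₂ : W₂ ⊆ S₂.toHomeo.source)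
    (h : ∀ i j, g.toHomeo '' (lagrangianGerm hrn S₁).values i j W₁ =
      (lagrangianGerm hrn S₂).values i j W₂) :
    MapsCaustics hrn S₁ S₂ g W₁ W₂ := by
  refine ⟨fun σ => .of_eq ?_, fun σ τ _ => .of_eq ?_⟩
  · rw [caustic_eq_values hW₁, caustic_eq_values hW₂, h]
  · rw [quasiCaustic_eq_values hW₁, quasiCaustic_eq_values hW₂, h]

theorem CausticEquivalent.of_equivOver {S₁ S₂ : SymplecticGerm n}
    (g : DiffeoGerm (Fin n → ℝ) (Fin n → ℝ))
    (H : (lagrangianGerm hrn S₁).EquivOver (lagrangianGerm hrn S₂) g.toHomeo) :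
    CausticEquivalent hrn S₁ S₂ := by
  have hproj : ∀ S : SymplecticGerm n, Tendsto (fun z => (S.toHomeo z).1) (𝓝 0) (𝓝 0) :=
    fun S => continuous_fst.continuousAt.tendsto.comp S.tendsto
  have H' := H.symm ((hproj S₁).eventually g.eventually_symm_apply)
  refine ⟨g, fun W hW => ?_⟩
  obtain ⟨U₁, hU₁, hvalues⟩ := H.exists_values_eq (inter_mem hW S₂.source_mem)
  obtain ⟨U₂, hU₂, hvalues'⟩ := H'.exists_values_eq_symm
    ((hproj S₂).eventually g.symm.eventually_symm_apply) (inter_mem hW S₁.source_mem)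
  refine ⟨_, inter_mem (inter_mem hU₁ S₁.source_mem) (inter_mem hU₂ S₂.source_mem),
    fun W₁ hW₁ hsub => ?_, fun W₂ hW₂ hsub => ?_⟩
  · obtain ⟨W₂, hW₂, hW₂W, heq⟩ := hvalues W₁ hW₁ fun z hz => (hsub hz).1.1
    exact ⟨W₂, hW₂, fun z hz => (hW₂W hz).1,
      .of_values_eq (fun z hz => (hsub hz).1.2) (fun z hz => (hW₂W hz).2) heq⟩
  · obtain ⟨W₁, hW₁, hW₁W, heq⟩ := hvalues' W₂ hW₂ fun z hz => (hsub hz).2.1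
    exact ⟨W₁, hW₁, fun z hz => (hW₁W hz).1,
      .of_values_eq (fun z hz => (hW₁W hz).2) (fun z hz => (hsub hz).2.2) heq⟩

end LagrangianGerm

/-! ### First and second derivatives -/

section Calculus

variable {E F G : Type*} [NormedAddCommGroup E] [NormedSpace ℝ E] [NormedAddCommGroup F]
  [NormedSpace ℝ F] [NormedAddCommGroup G] [NormedSpace ℝ G]

theorem differentiableAt_fderiv_of_contDiffAt {f : E → F} {z : E} (hf : ContDiffAt ℝ 2 f z) :
    DifferentiableAt ℝ (fderiv ℝ f) z :=
  (hf.fderiv_right (m := 1) (by norm_num)).differentiableAt (by norm_num)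

theorem hasFDerivAt_fderiv_apply {f : E → F} {z : E} (hf : ContDiffAt ℝ 2 f z) (w : E) :
    HasFDerivAt (fun x => fderiv ℝ f x w) ((fderiv ℝ (fderiv ℝ f) z).flip w) z :=
  (ContinuousLinearMap.apply ℝ F w).hasFDerivAt.comp z
    (differentiableAt_fderiv_of_contDiffAt hf).hasFDerivAt

theorem fderiv_fderiv_comp_apply {g : F → G} {f : E → F} {z : E}
    (hg : ContDiffAt ℝ 2 g (f z)) (hf : ContDiffAt ℝ 2 f z) (u w : E) :
    fderiv ℝ (fderiv ℝ (g ∘ f)) z u w =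
      fderiv ℝ (fderiv ℝ g) (f z) (fderiv ℝ f z u) (fderiv ℝ f z w) +
        fderiv ℝ g (f z) (fderiv ℝ (fderiv ℝ f) z u w) := by
  have hcomp : (fun x => fderiv ℝ (g ∘ f) x w) =ᶠ[𝓝 z]
      fun x => fderiv ℝ g (f x) (fderiv ℝ f x w) := by
    filter_upwards [hf.continuousAt.eventually (hg.eventually (by simp)),
      hf.eventually (by simp)] with x hgx hfx
    rw [fderiv_comp x (hgx.differentiableAt (by simp)) (hfx.differentiableAt (by simp))]
    rfl
  have hfd := (hf.differentiableAt (by simp)).hasFDerivAt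
  have hderiv := (((differentiableAt_fderiv_of_contDiffAt hg).hasFDerivAt.comp z hfd).clm_apply
    (hasFDerivAt_fderiv_apply hf w)).congr_of_eventuallyEq hcomp
  rw [← ContinuousLinearMap.flip_apply,
    (hasFDerivAt_fderiv_apply (hg.comp z hf) w).unique hderiv, add_comm]
  rfl

section AffineReparametrization

variable {a b f : E → ℝ} {z u w : E}

theorem fderiv_mul_add_apply (ha : DifferentiableAt ℝ a z) (hb : DifferentiableAt ℝ b z)
    (hf : DifferentiableAt ℝ f z) (haw : fderiv ℝ a z w = 0) (hbw : fderiv ℝ b z w = 0) :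
    fderiv ℝ (fun x => a x * f x + b x) z w = a z * fderiv ℝ f z w := by
  rw [((ha.hasFDerivAt.fun_mul hf.hasFDerivAt).fun_add hb.hasFDerivAt).fderiv]
  simp [haw, hbw]

theorem fderiv_fderiv_mul_add_apply (ha : ContDiffAt ℝ 2 a z) (hb : ContDiffAt ℝ 2 b z)
    (hf : ContDiffAt ℝ 2 f z) (haw : ∀ᶠ x in 𝓝 z, fderiv ℝ a x w = 0)
    (hbw : ∀ᶠ x in 𝓝 z, fderiv ℝ b x w = 0) (hau : fderiv ℝ a z u = 0) :
    fderiv ℝ (fderiv ℝ fun x => a x * f x + b x) z u w =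
      a z * fderiv ℝ (fderiv ℝ f) z u w := by
  have hfirst : (fun x => fderiv ℝ (fun x => a x * f x + b x) x w) =ᶠ[𝓝 z]
      fun x => a x * fderiv ℝ f x w + 0 := by
    filter_upwards [ha.eventually (by simp), hb.eventually (by simp), hf.eventually (by simp),
      haw, hbw] with x hax hbx hfx haw hbw
    rw [add_zero, fderiv_mul_add_apply (hax.differentiableAt (by simp))
      (hbx.differentiableAt (by simp)) (hfx.differentiableAt (by simp)) haw hbw]
  rw [← ContinuousLinearMap.flip_apply,
    ← (hasFDerivAt_fderiv_apply ((ha.mul hf).add hb) w).fderiv, hfirst.fderiv_eq,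
    fderiv_mul_add_apply (ha.differentiableAt (by simp)) (differentiableAt_const _)
      (hasFDerivAt_fderiv_apply hf w).differentiableAt hau (by simp),
    (hasFDerivAt_fderiv_apply hf w).fderiv, ContinuousLinearMap.flip_apply]

end AffineReparametrization

section Fibers

variable {B B' : Type*} [NormedAddCommGroup B] [NormedSpace ℝ B] [NormedAddCommGroup B']
  [NormedSpace ℝ B'] {f : E → F} {z u w : E} {L : E →L[ℝ] B} {L' : F →L[ℝ] B'}

theorem apply_fderiv_eq_zero_of_mapsTo_fiber (hf : DifferentiableAt ℝ f z)
    (h : ∀ᶠ x in 𝓝 z, L x = L z → L' (f x) = L' (f z)) (hw : L w = 0) :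
    L' (fderiv ℝ f z w) = 0 := by
  have hline : HasDerivAt (fun t : ℝ => L' (f (z + t • w))) (L' (fderiv ℝ f z w)) 0 :=
    (L'.hasFDerivAt.comp z hf.hasFDerivAt).hasLineDerivAt w
  have hpath : Tendsto (fun t : ℝ => z + t • w) (𝓝 0) (𝓝 z) := by
    simpa using (by fun_prop : Continuous fun t : ℝ => z + t • w).tendsto 0
  refine hline.unique ((hasDerivAt_const (0 : ℝ) (L' (f z))).congr_of_eventuallyEq ?_)
  filter_upwards [hpath.eventually h] with t ht using ht (by simp [hw])

theorem apply_fderiv_fderiv_eq_zero_of_mapsTo_fiber (hf : ContDiffAt ℝ 2 f z)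
    (h : ∀ᶠ x in 𝓝 z, L x = L z → L' (f x) = L' (f z)) (hu : L u = 0) (hw : L w = 0) :
    L' (fderiv ℝ (fderiv ℝ f) z u w) = 0 := by
  have hfirst : ∀ᶠ x in 𝓝 z, L x = L z → L' (fderiv ℝ f x w) = 0 := by
    filter_upwards [h.eventually_nhds, hf.eventually (by simp)] with x hx hfx hLx
    refine apply_fderiv_eq_zero_of_mapsTo_fiber (hfx.differentiableAt (by simp)) ?_ hw
    filter_upwards [hx] with y hy hLy
    rw [hy (hLy.trans hLx), hx.self_of_nhds hLx]
  have hderiv := hasFDerivAt_fderiv_apply hf w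
  rw [← ContinuousLinearMap.flip_apply, ← hderiv.fderiv]
  refine apply_fderiv_eq_zero_of_mapsTo_fiber hderiv.differentiableAt ?_ hu
  filter_upwards [hfirst] with x hx hLx
  rw [hx hLx, hfirst.self_of_nhds rfl]

end Fibers

section Within

variable {f g : E → F} {s : Set E} {z : E}

theorem fderiv_eq_of_eventuallyEq_nhdsWithin (hs : UniqueDiffWithinAt ℝ s z) (hz : z ∈ s)
    (hf : DifferentiableAt ℝ f z) (hg : DifferentiableAt ℝ g z) (h : f =ᶠ[𝓝[s] z] g) :
    fderiv ℝ f z = fderiv ℝ g z := by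
  rw [← hf.fderivWithin hs, ← hg.fderivWithin hs, h.fderivWithin_eq_of_mem hz]

theorem eventually_fderiv_eq_of_eqOn (hs : UniqueDiffOn ℝ s) (hf : ContDiffAt ℝ 2 f z)
    (hg : ContDiffAt ℝ 2 g z) (h : f =ᶠ[𝓝[s] z] g) :
    ∀ᶠ x in 𝓝[s] z, fderiv ℝ f x = fderiv ℝ g x ∧
      fderiv ℝ (fderiv ℝ f) x = fderiv ℝ (fderiv ℝ g) x := by
  have hf' := (hf.eventually (by simp)).filter_mono (nhdsWithin_le_nhds (s := s))
  have hg' := (hg.eventually (by simp)).filter_mono (nhdsWithin_le_nhds (s := s))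
  have hfirst : fderiv ℝ f =ᶠ[𝓝[s] z] fderiv ℝ g := by
    filter_upwards [eventually_eventually_nhdsWithin.2 h, hf', hg', self_mem_nhdsWithin]
      with x hx hfx hgx hxs
    exact fderiv_eq_of_eventuallyEq_nhdsWithin (hs x hxs) hxs (hfx.differentiableAt (by simp))
      (hgx.differentiableAt (by simp)) hx
  filter_upwards [eventually_eventually_nhdsWithin.2 hfirst, hf', hg', self_mem_nhdsWithin]
    with x hx hfx hgx hxs
  exact ⟨hx.self_of_nhdsWithin hxs, fderiv_eq_of_eventuallyEq_nhdsWithin (hs x hxs) hxs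
    (differentiableAt_fderiv_of_contDiffAt hfx) (differentiableAt_fderiv_of_contDiffAt hgx) hx⟩

theorem fderiv_apply_eq_of_mem_span_tangentConeAt (hz : z ∈ s) (hf : DifferentiableAt ℝ f z)
    (hg : DifferentiableAt ℝ g z) (h : f =ᶠ[𝓝[s] z] g) {v : E}
    (hv : v ∈ Submodule.span ℝ (tangentConeAt ℝ s z)) : fderiv ℝ f z v = fderiv ℝ g z v :=
  LinearMap.eqOn_span (f := (fderiv ℝ f z : E →ₗ[ℝ] F)) (g := (fderiv ℝ g z : E →ₗ[ℝ] F))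
    (hf.hasFDerivAt.hasFDerivWithinAt.unique_on
      (hg.hasFDerivAt.hasFDerivWithinAt.congr_of_eventuallyEq h (h.self_of_nhdsWithin hz))) hv

end Within

end Calculus

/-! ### Fiberwise critical points -/

section FiberDirections

variable {r k n : ℕ}

/-- The point `(q, x_σ)` of the base of the projection whose fibers carry the remaining variables
`x_{I_r - σ}` and `y`. -/
def baseCoord (r k n : ℕ) (σ : Finset (Fin r)) :
    XYQ r k n →L[ℝ] (Fin n → ℝ) × (σ → ℝ) :=
  ((ContinuousLinearMap.snd ℝ _ _).comp (ContinuousLinearMap.snd ℝ _ _)).prod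
    (.pi fun i : σ => (ContinuousLinearMap.proj (i : Fin r)).comp (ContinuousLinearMap.fst ℝ _ _))

/-- The directions along `x_{I_r - σ}` and `y`. -/
def fiberDir (r k n : ℕ) (σ : Finset (Fin r)) : Submodule ℝ (XYQ r k n) :=
  (baseCoord r k n σ).ker

theorem baseCoord_eq_iff {σ : Finset (Fin r)} {w z : XYQ r k n} :
    baseCoord r k n σ w = baseCoord r k n σ z ↔ w.2.2 = z.2.2 ∧ ∀ i ∈ σ, w.1 i = z.1 i := by
  rw [Prod.ext_iff, funext_iff (f := (baseCoord r k n σ w).2), Subtype.forall]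
  rfl

theorem mem_fiberDir {σ : Finset (Fin r)} {w : XYQ r k n} :
    w ∈ fiberDir r k n σ ↔ w.2.2 = 0 ∧ ∀ i ∈ σ, w.1 i = 0 := by
  rw [fiberDir, LinearMap.mem_ker, ContinuousLinearMap.coe_coe,
    ← map_zero (baseCoord r k n σ), baseCoord_eq_iff]
  rfl

theorem apply_eq_sum_single (L : XYQ r k n →L[ℝ] ℝ) (w : XYQ r k n) :
    L w = ∑ i, w.1 i * L (Pi.single i 1, 0, 0) + ∑ j, w.2.1 j * L (0, Pi.single j 1, 0) +
      ∑ l, w.2.2 l * L (0, 0, Pi.single l 1) := by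
  have hw : w = ∑ i, w.1 i • (Pi.single i 1, 0, 0) + ∑ j, w.2.1 j • (0, Pi.single j 1, 0) +
      ∑ l, w.2.2 l • (0, 0, Pi.single l 1) := by
    ext <;> simp [Prod.fst_sum, Prod.snd_sum, Finset.sum_apply, Pi.single_apply]
  simpa only [map_add, map_sum, map_smul, smul_eq_mul] using congrArg L hw

theorem forall_mem_fiberDir_apply_eq_zero_iff {σ : Finset (Fin r)} {L : XYQ r k n →L[ℝ] ℝ} :
    (∀ w ∈ fiberDir r k n σ, L w = 0) ↔
      (∀ i ∉ σ, L (Pi.single i 1, 0, 0) = 0) ∧ ∀ j, L (0, Pi.single j 1, 0) = 0 := by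
  refine ⟨fun h => ⟨fun i hi => h _ (mem_fiberDir.2 ⟨rfl, fun i' hi' => ?_⟩),
    fun j => h _ (mem_fiberDir.2 ⟨rfl, fun _ _ => rfl⟩)⟩, ?_⟩
  · exact Pi.single_eq_of_ne (ne_of_mem_of_not_mem hi' hi) _
  · rintro ⟨hx, hy⟩ w hw
    obtain ⟨hq, hσ⟩ := mem_fiberDir.1 hw
    have hterm : ∀ i, w.1 i * L (Pi.single i 1, 0, 0) = 0 := fun i => by
      by_cases hi : i ∈ σ
      · rw [hσ i hi, zero_mul]
      · rw [hx i hi, mul_zero]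
    simp [apply_eq_sum_single L w, hterm, hy, hq]

theorem mem_fiberCritical_iff {F : XYQ r k n → ℝ} {σ : Finset (Fin r)} {z : XYQ r k n} :
    z ∈ fiberCritical F σ ↔
      z ∈ corner r k n ∧ (∀ i ∈ σ, z.1 i = 0) ∧ ∀ w ∈ fiberDir r k n σ, fderiv ℝ F z w = 0 := by
  rw [forall_mem_fiberDir_apply_eq_zero_iff]
  rfl

end FiberDirections

section Degeneracy

variable {E E' : Type*} [NormedAddCommGroup E] [NormedSpace ℝ E] [NormedAddCommGroup E']
  [NormedSpace ℝ E']

/-- The bilinear form `B` has a nonzero kernel when restricted to `N`. -/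
def DegenerateOn (B : E →L[ℝ] E →L[ℝ] ℝ) (N : Submodule ℝ E) : Prop :=
  ∃ u ∈ N, u ≠ 0 ∧ ∀ w ∈ N, B u w = 0

theorem degenerateOn_iff_of_map_eq {B : E →L[ℝ] E →L[ℝ] ℝ} {B' : E' →L[ℝ] E' →L[ℝ] ℝ}
    {N : Submodule ℝ E} {N' : Submodule ℝ E'} {T : E →ₗ[ℝ] E'} (hT : Function.Injective T)
    (hN : N.map T = N') {c : ℝ} (hc : c ≠ 0)
    (hB : ∀ u ∈ N, ∀ w ∈ N, B u w = c * B' (T u) (T w)) :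
    DegenerateOn B N ↔ DegenerateOn B' N' := by
  simp only [DegenerateOn, ← hN, Submodule.mem_map, exists_exists_and_eq_and,
    forall_exists_index, and_imp, forall_apply_eq_imp_iff₂]
  refine exists_congr fun u => and_congr_right fun hu => and_congr ?_ (forall₂_congr fun w hw => ?_)
  · rw [ne_eq, ne_eq, map_eq_zero_iff T hT]
  · rw [hB u hu w hw, mul_eq_zero, or_iff_right hc]

/-- The points where the second derivative of `F` along the fibers over `(q, x_σ)` is
degenerate. -/
def degeneratePoints {r k n : ℕ} (F : XYQ r k n → ℝ) (σ : Finset (Fin r)) : Set (XYQ r k n) :=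
  {z | DegenerateOn (fderiv ℝ (fderiv ℝ F) z) (fiberDir r k n σ)}

/-- The projection to the parameters `q` of the fiberwise critical points of `F`, with the strata
and their degenerate points as marks. -/
def fiberGerm {r k n : ℕ} (F : XYQ r k n → ℝ) :
    MarkedGerm (Finset (Fin r) ⊕ Finset (Fin r)) (XYQ r k n) (Fin n → ℝ) :=
  .ofStrata (𝓝 0) (fiberCritical F) (degeneratePoints F) fun z => z.2.2

end Degeneracy

section QuadraticForm

variable {V : Type*} [NormedAddCommGroup V] [NormedSpace ℝ V] [FiniteDimensional ℝ V]

theorem contDiff_quadraticForm (Q : QuadraticForm ℝ V) : ContDiff ℝ ∞ Q := by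
  have hQ : ⇑Q = fun y => (QuadraticMap.associated Q).toContinuousBilinearMap y y :=
    funext fun y => (QuadraticMap.associated_eq_self_apply ℝ Q y).symm
  rw [hQ]
  exact (ContinuousLinearMap.contDiff _).clm_apply contDiff_id

theorem fderiv_quadraticForm_apply (Q : QuadraticForm ℝ V) (y v : V) :
    fderiv ℝ Q y v = QuadraticMap.polar Q y v := by
  rw [← ((contDiff_quadraticForm Q).differentiable (by simp) y).lineDeriv_eq_fderiv,
    QuadraticMap.lineDeriv]

theorem fderiv_fderiv_quadraticForm_apply (Q : QuadraticForm ℝ V) (y u v : V) :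
    fderiv ℝ (fderiv ℝ Q) y u v = QuadraticMap.polar Q u v := by
  have hlinear : (fun y => fderiv ℝ Q y v) =
      LinearMap.toContinuousLinearMap (Q.polarBilin.flip v) :=
    funext fun y => fderiv_quadraticForm_apply Q y v
  have hderiv := hasFDerivAt_fderiv_apply
    ((contDiff_infty.1 (contDiff_quadraticForm Q) 2).contDiffAt (x := y)) v
  rw [← ContinuousLinearMap.flip_apply, ← hderiv.fderiv, hlinear,
    ContinuousLinearMap.fderiv]
  rfl

end QuadraticForm

section AddQuadratic

variable {r k l n : ℕ}

/-- Separate the last `l` variables `y` from the other variables. -/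
noncomputable def splitY (r k l n : ℕ) : XYQ r (k + l) n ≃L[ℝ] XYQ r k n × (Fin l → ℝ) :=
  LinearEquiv.toContinuousLinearEquiv
    { toFun := fun z => ((z.1, fun j => z.2.1 (Fin.castAdd l j), z.2.2),
        fun j => z.2.1 (Fin.natAdd k j))
      invFun := fun p => (p.1.1, Fin.append p.1.2.1 p.2, p.1.2.2)
      map_add' := fun _ _ => rfl
      map_smul' := fun _ _ => rfl
      left_inv := fun _ => Prod.ext rfl (Prod.ext Fin.append_castAdd_natAdd rfl)
      right_inv := fun _ => by simp }

theorem splitY_symm_mem_fiberDir {σ : Finset (Fin r)} {w : XYQ r k n}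
    (hw : w ∈ fiberDir r k n σ) (v : Fin l → ℝ) :
    (splitY r k l n).symm (w, v) ∈ fiberDir r (k + l) n σ :=
  hw

variable {F : XYQ r k n → ℝ} {Q : QuadraticForm ℝ (Fin l → ℝ)} {z : XYQ r (k + l) n}

theorem contDiffAt_addQuadratic (hF : ContDiffAt ℝ 2 F (splitY r k l n z).1)
    (Q : QuadraticForm ℝ (Fin l → ℝ)) : ContDiffAt ℝ 2 (addQuadratic F Q) z :=
  (hF.comp z (splitY r k l n).contDiff.fst.contDiffAt).add
    ((contDiff_infty.1 (contDiff_quadraticForm Q) 2).comp (splitY r k l n).contDiff.snd).contDiffAt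

theorem fderiv_addQuadratic_apply (hF : DifferentiableAt ℝ F (splitY r k l n z).1)
    (Q : QuadraticForm ℝ (Fin l → ℝ)) (w : XYQ r (k + l) n) :
    fderiv ℝ (addQuadratic F Q) z w = fderiv ℝ F (splitY r k l n z).1 (splitY r k l n w).1 +
      QuadraticMap.polar Q (splitY r k l n z).2 (splitY r k l n w).2 := by
  have hsplit := (splitY r k l n).hasFDerivAt (x := z)
  have hQ := (contDiff_quadraticForm Q).differentiable (by simp) (splitY r k l n z).2
  have hderiv : HasFDerivAt (addQuadratic F Q) _ z :=
    (hF.hasFDerivAt.comp z hsplit.fst).add (hQ.hasFDerivAt.comp z hsplit.snd)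
  rw [hderiv.fderiv, ← fderiv_quadraticForm_apply]
  rfl

theorem fderiv_fderiv_addQuadratic_apply (hF : ContDiffAt ℝ 2 F (splitY r k l n z).1)
    (Q : QuadraticForm ℝ (Fin l → ℝ)) (u w : XYQ r (k + l) n) :
    fderiv ℝ (fderiv ℝ (addQuadratic F Q)) z u w =
      fderiv ℝ (fderiv ℝ F) (splitY r k l n z).1 (splitY r k l n u).1 (splitY r k l n w).1 +
        QuadraticMap.polar Q (splitY r k l n u).2 (splitY r k l n w).2 := by
  have hQ₂ := (contDiff_infty.1 (contDiff_quadraticForm Q) 2).contDiffAt (x := (splitY r k l n z).2)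
  have hsplit := (splitY r k l n).hasFDerivAt (x := z)
  have hfirst : (fun x => fderiv ℝ (addQuadratic F Q) x w) =ᶠ[𝓝 z] fun x =>
      fderiv ℝ F (splitY r k l n x).1 (splitY r k l n w).1 +
        fderiv ℝ Q (splitY r k l n x).2 (splitY r k l n w).2 := by
    filter_upwards [(splitY r k l n).continuous.fst.continuousAt.eventually
      (hF.eventually (by simp))] with x hx
    rw [fderiv_addQuadratic_apply (hx.differentiableAt (by simp)), fderiv_quadraticForm_apply]
  have hderiv := ((hasFDerivAt_fderiv_apply hF (splitY r k l n w).1).comp z hsplit.fst).add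
    ((hasFDerivAt_fderiv_apply hQ₂ (splitY r k l n w).2).comp z hsplit.snd)
  rw [← ContinuousLinearMap.flip_apply, ← fderiv_fderiv_quadraticForm_apply Q _ _ _,
    (hasFDerivAt_fderiv_apply (contDiffAt_addQuadratic hF Q) w).unique
      (hderiv.congr_of_eventuallyEq hfirst)]
  rfl

theorem forall_mem_fiberDir_add_polar_eq_zero_iff (hQ : Q.polarBilin.Nondegenerate)
    {σ : Finset (Fin r)} {L : XYQ r k n →L[ℝ] ℝ} {y : Fin l → ℝ} :
    (∀ w ∈ fiberDir r (k + l) n σ,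
      L (splitY r k l n w).1 + QuadraticMap.polar Q y (splitY r k l n w).2 = 0) ↔
      (∀ w ∈ fiberDir r k n σ, L w = 0) ∧ y = 0 := by
  constructor
  · refine fun h => ⟨fun w hw => ?_, hQ.1 y fun v => ?_⟩
    · simpa using h _ (splitY_symm_mem_fiberDir hw 0)
    · simpa using h _ (splitY_symm_mem_fiberDir (zero_mem _) v)
  · rintro ⟨hL, rfl⟩ w hw
    rw [hL _ hw, QuadraticMap.polar_zero_left, add_zero]

theorem mem_fiberCritical_addQuadratic_iff (hF : DifferentiableAt ℝ F (splitY r k l n z).1)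
    (hQ : Q.polarBilin.Nondegenerate) {σ : Finset (Fin r)} :
    z ∈ fiberCritical (addQuadratic F Q) σ ↔
      (splitY r k l n z).1 ∈ fiberCritical F σ ∧ (splitY r k l n z).2 = 0 := by
  simp only [mem_fiberCritical_iff, fderiv_addQuadratic_apply hF,
    forall_mem_fiberDir_add_polar_eq_zero_iff hQ, and_assoc]
  rfl

theorem mem_degeneratePoints_addQuadratic_iff (hF : ContDiffAt ℝ 2 F (splitY r k l n z).1)
    (hQ : Q.polarBilin.Nondegenerate) {σ : Finset (Fin r)} :
    z ∈ degeneratePoints (addQuadratic F Q) σ ↔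
      (splitY r k l n z).1 ∈ degeneratePoints F σ := by
  simp only [degeneratePoints, DegenerateOn, mem_ofPred_eq, fderiv_fderiv_addQuadratic_apply hF,
    forall_mem_fiberDir_add_polar_eq_zero_iff hQ]
  constructor
  · rintro ⟨u, hu, hu0, hker, hlast⟩
    refine ⟨_, hu, fun hfst => hu0 ?_, hker⟩
    exact (splitY r k l n).map_eq_zero_iff.1 (Prod.ext hfst hlast)
  · rintro ⟨u, hu, hu0, hker⟩
    refine ⟨_, splitY_symm_mem_fiberDir hu 0, fun h => hu0 ?_, by simpa using hker, by simp⟩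
    simpa using h

theorem fiberGerm_equivOver_addQuadratic (hF : ContDiffAt ℝ 2 F 0)
    (hQ : Q.polarBilin.Nondegenerate) :
    (fiberGerm F).EquivOver (fiberGerm (addQuadratic F Q)) id := by
  have hdrop : Tendsto (fun z => (splitY r k l n z).1) (𝓝 0) (𝓝 0) := by
    simpa using (splitY r k l n).continuous.fst.tendsto 0
  have happend : Tendsto (fun z => (splitY r k l n).symm (z, 0)) (𝓝 0) (𝓝 0) := by
    simpa only [Function.comp_def, Prod.mk_zero_zero, map_zero]
      using ((splitY r k l n).symm.continuous.comp (.prodMk_left 0)).tendsto 0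
  have hF' : ∀ᶠ z in 𝓝 0, ContDiffAt ℝ 2 F z := hF.eventually (by simp)
  refine MarkedGerm.ofStrata_equivOver happend hdrop ?_ ?_ ?_
  · filter_upwards [hF'] with z hz σ hσ
    exact ⟨(mem_fiberCritical_addQuadratic_iff (by simpa using hz.differentiableAt (by simp))
      hQ).2 (by simpa using hσ), by simp, rfl⟩
  · filter_upwards [hdrop.eventually hF'] with z hz σ hσ
    obtain ⟨hcrit, hlast⟩ :=
      (mem_fiberCritical_addQuadratic_iff (hz.differentiableAt (by simp)) hQ).1 hσ
    exact ⟨hcrit, by rw [← hlast]; simp⟩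
  · filter_upwards [hF'] with z hz σ _
    rw [mem_degeneratePoints_addQuadratic_iff (by simpa using hz) hQ]
    simp

end AddQuadratic

/-! ### Reticular `𝒫`-`𝒞`-equivalence -/

theorem uniqueDiffOn_corner (r k n : ℕ) : UniqueDiffOn ℝ (corner r k n) := by
  have hcorner : corner r k n = Ici (0 : Fin r → ℝ) ×ˢ univ :=
    Set.ext fun z => ⟨fun hz => ⟨hz, mem_univ _⟩, fun hz => hz.1⟩
  rw [hcorner, ← pi_univ_Ici]
  exact (UniqueDiffOn.univ_pi fun i => uniqueDiffOn_Ici _).prod uniqueDiffOn_univ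

namespace IsReticularDiffeo

variable {r k k' n : ℕ} {Φ : DiffeoGerm (XYQ r k' n) (XYQ r k n)} {σ : Finset (Fin r)}
  {z u w : XYQ r k' n}

theorem fst_apply_eq_zero (hΦ : IsReticularDiffeo Φ) (hz : z ∈ Φ.toHomeo.source) {i : Fin r}
    (hi : z.1 i = 0) : (Φ.toHomeo z).1 i = 0 := by
  obtain ⟨φ, -, hφ⟩ := hΦ.2.1
  rw [hφ z hz i, hi, zero_mul]

theorem eventually_baseCoord_eq (hΦ : IsReticularDiffeo Φ) (hz : z ∈ Φ.toHomeo.source)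
    (hσ : ∀ i ∈ σ, z.1 i = 0) :
    ∀ᶠ x in 𝓝 z, baseCoord r k' n σ x = baseCoord r k' n σ z →
      baseCoord r k n σ (Φ.toHomeo x) = baseCoord r k n σ (Φ.toHomeo z) := by
  obtain ⟨ψ, hψ⟩ := hΦ.2.2
  filter_upwards [Φ.toHomeo.open_source.mem_nhds hz] with x hx hxz
  obtain ⟨hq, hxσ⟩ := baseCoord_eq_iff.1 hxz
  refine baseCoord_eq_iff.2 ⟨by rw [hψ x hx, hψ z hz, hq], fun i hi => ?_⟩
  rw [hΦ.fst_apply_eq_zero hx ((hxσ i hi).trans (hσ i hi)), hΦ.fst_apply_eq_zero hz (hσ i hi)]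

theorem fderiv_mem_fiberDir (hΦ : IsReticularDiffeo Φ) (hz : z ∈ Φ.toHomeo.source)
    (hσ : ∀ i ∈ σ, z.1 i = 0) (hw : w ∈ fiberDir r k' n σ) :
    fderiv ℝ Φ.toHomeo z w ∈ fiberDir r k n σ :=
  apply_fderiv_eq_zero_of_mapsTo_fiber (Φ.differentiableAt hz)
    (hΦ.eventually_baseCoord_eq hz hσ) hw

theorem fderiv_fderiv_mem_fiberDir (hΦ : IsReticularDiffeo Φ) (hz : z ∈ Φ.toHomeo.source)
    (hσ : ∀ i ∈ σ, z.1 i = 0) (hu : u ∈ fiberDir r k' n σ) (hw : w ∈ fiberDir r k' n σ) :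
    fderiv ℝ (fderiv ℝ Φ.toHomeo) z u w ∈ fiberDir r k n σ :=
  apply_fderiv_fderiv_eq_zero_of_mapsTo_fiber (contDiffAt_infty.1 (Φ.contDiffAt hz) 2)
    (hΦ.eventually_baseCoord_eq hz hσ) hu hw

theorem map_fiberDir (hΦ : IsReticularDiffeo Φ) (hz : z ∈ Φ.toHomeo.source)
    (hσ : ∀ i ∈ σ, z.1 i = 0) :
    (fiberDir r k' n σ).map (fderiv ℝ Φ.toHomeo z : XYQ r k' n →ₗ[ℝ] XYQ r k n) =
      fiberDir r k n σ := by
  have hk : k' = k := by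
    simpa using (Φ.fderivEquiv hz).toLinearEquiv.finrank_eq
  subst hk
  refine Submodule.eq_of_le_of_finrank_eq ?_
    (LinearEquiv.finrank_map_eq (Φ.fderivEquiv hz).toLinearEquiv _)
  rintro _ ⟨w, hw, rfl⟩
  exact hΦ.fderiv_mem_fiberDir hz hσ hw

theorem eventually_fst_apply_eq_zero_iff (hΦ : IsReticularDiffeo Φ) :
    ∀ᶠ z in 𝓝 0, ∀ i, (Φ.toHomeo z).1 i = 0 ↔ z.1 i = 0 := by
  obtain ⟨φ, hφ_smooth, hφ⟩ := hΦ.2.1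
  refine eventually_all.2 fun i => ?_
  have hφi : DifferentiableAt ℝ (fun z => φ z i) 0 := differentiableAt_pi.1
    ((hφ_smooth.contDiffAt Φ.source_mem).differentiableAt (by simp)) i
  have hφ0 : φ 0 i ≠ 0 := fun h => by
    let coord (m : ℕ) : XYQ r m n →L[ℝ] ℝ := (ContinuousLinearMap.proj i).comp (.fst ℝ _ _)
    have hproduct := ((coord k').hasFDerivAt.mul hφi.hasFDerivAt).congr_of_eventuallyEq
      (mem_of_superset Φ.source_mem fun z hz => hφ z hz i)
    have hcoord := ((coord k).hasFDerivAt.comp 0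
      (Φ.differentiableAt Φ.zero_mem).hasFDerivAt).unique hproduct
    obtain ⟨w, hw⟩ := (Φ.fderivEquiv Φ.zero_mem).surjective (Pi.single i 1, 0, 0)
    have hone : coord k (fderiv ℝ Φ.toHomeo 0 w) = 1 := by
      rw [← Φ.coe_fderivEquiv Φ.zero_mem, ContinuousLinearEquiv.coe_coe, hw]
      exact Pi.single_eq_same i 1
    rw [← ContinuousLinearMap.comp_apply, hcoord] at hone
    simp [h] at hone
  filter_upwards [hφi.continuousAt.eventually_ne hφ0, Φ.source_mem] with z hz hzs
  rw [hφ z hzs i, mul_eq_zero, or_iff_left hz]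

end IsReticularDiffeo

section PCEquivalence

variable {r k k' n : ℕ}

theorem eventually_fderiv_comp_snd_snd_apply_eq_zero {c : (Fin n → ℝ) → ℝ}
    (hc : ContDiffAt ℝ 2 c 0) :
    ∀ᶠ z : XYQ r k n in 𝓝 0, ContDiffAt ℝ 2 (fun x : XYQ r k n => c x.2.2) z ∧
      ∀ w, w.2.2 = 0 → ∀ᶠ x in 𝓝 z, fderiv ℝ (fun x : XYQ r k n => c x.2.2) x w = 0 := by
  have hc' : ∀ᶠ x : XYQ r k n in 𝓝 0, ContDiffAt ℝ 2 c x.2.2 :=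
    (continuous_snd.snd.tendsto _).eventually (hc.eventually (by simp))
  filter_upwards [hc'.eventually_nhds] with z hz
  refine ⟨hz.self_of_nhds.comp z contDiffAt_snd.snd, fun w hw => ?_⟩
  filter_upwards [hz] with x hx
  have hderiv : HasFDerivAt (fun x : XYQ r k n => c x.2.2) _ x :=
    HasFDerivAt.comp x (hx.differentiableAt (by simp)).hasFDerivAt hasFDerivAt_snd.snd
  rw [hderiv.fderiv]
  simp [hw]

variable {Φ : DiffeoGerm (XYQ r k' n) (XYQ r k n)} {F : XYQ r k n → ℝ} {G : XYQ r k' n → ℝ}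
  {a b : (Fin n → ℝ) → ℝ}

theorem eventually_fderiv_eq_of_eq_mul_comp_add (ha : ContDiffAt ℝ 2 a 0)
    (hb : ContDiffAt ℝ 2 b 0) (hF : ContDiffAt ℝ 2 F 0) (hG : ContDiffAt ℝ 2 G 0)
    (h : ∀ᶠ z in 𝓝[corner r k' n] 0, G z = a z.2.2 * F (Φ.toHomeo z) + b z.2.2) :
    ∀ᶠ z in 𝓝[corner r k' n] 0, ∀ u w : XYQ r k' n, u.2.2 = 0 → w.2.2 = 0 →
      fderiv ℝ G z w = a z.2.2 * fderiv ℝ F (Φ.toHomeo z) (fderiv ℝ Φ.toHomeo z w) ∧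
      fderiv ℝ (fderiv ℝ G) z u w = a z.2.2 *
        (fderiv ℝ (fderiv ℝ F) (Φ.toHomeo z) (fderiv ℝ Φ.toHomeo z u) (fderiv ℝ Φ.toHomeo z w) +
          fderiv ℝ F (Φ.toHomeo z) (fderiv ℝ (fderiv ℝ Φ.toHomeo) z u w)) := by
  have hΦ {z} (hz : z ∈ Φ.toHomeo.source) := contDiffAt_infty.1 (Φ.contDiffAt hz) 2
  have hF' := Φ.tendsto.eventually (hF.eventually (by simp))
  have ha' := eventually_fderiv_comp_snd_snd_apply_eq_zero (r := r) (k := k') ha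
  have hb' := eventually_fderiv_comp_snd_snd_apply_eq_zero (r := r) (k := k') hb
  have hK : ContDiffAt ℝ 2 (fun z => a z.2.2 * F (Φ.toHomeo z) + b z.2.2) 0 :=
    (ha'.self_of_nhds.1.mul (hF'.self_of_nhds.comp 0 (hΦ Φ.zero_mem))).add hb'.self_of_nhds.1
  filter_upwards [eventually_fderiv_eq_of_eqOn (uniqueDiffOn_corner r k' n) hG hK h,
    nhdsWithin_le_nhds Φ.source_mem, nhdsWithin_le_nhds ha', nhdsWithin_le_nhds hb',
    nhdsWithin_le_nhds hF'] with z hGK hz haz hbz hFz u w hu hw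
  obtain ⟨haz, hadir⟩ := haz
  obtain ⟨hbz, hbdir⟩ := hbz
  have hFΦ : ContDiffAt ℝ 2 (F ∘ Φ.toHomeo) z := hFz.comp z (hΦ hz)
  rw [hGK.1, hGK.2]
  constructor
  · refine (fderiv_mul_add_apply (haz.differentiableAt (by simp)) (hbz.differentiableAt (by simp))
      (hFΦ.differentiableAt (by simp)) (hadir w hw).self_of_nhds
      (hbdir w hw).self_of_nhds).trans ?_
    rw [fderiv_comp z (hFz.differentiableAt (by simp)) (Φ.differentiableAt hz)]
    rfl
  · refine (fderiv_fderiv_mul_add_apply haz hbz hFΦ (hadir w hw) (hbdir w hw)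
      (hadir u hu).self_of_nhds).trans ?_
    rw [fderiv_fderiv_comp_apply hFz (hΦ hz)]

theorem fiberGerm_equivOver_of_eq_mul_comp_add (hΦ : IsReticularDiffeo Φ)
    {ψ : (Fin n → ℝ) → (Fin n → ℝ)}
    (hψ : ∀ z ∈ Φ.toHomeo.source, (Φ.toHomeo z).2.2 = ψ z.2.2) (ha : ContDiffAt ℝ 2 a 0)
    (ha0 : a 0 ≠ 0) (hb : ContDiffAt ℝ 2 b 0) (hF : ContDiffAt ℝ 2 F 0) (hG : ContDiffAt ℝ 2 G 0)
    (h : ∀ᶠ z in 𝓝[corner r k' n] 0, G z = a z.2.2 * F (Φ.toHomeo z) + b z.2.2) :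
    (fiberGerm G).EquivOver (fiberGerm F) ψ := by
  have hderiv := eventually_nhdsWithin_iff.1
    (eventually_fderiv_eq_of_eq_mul_comp_add ha hb hF hG h)
  have hq : Tendsto (fun z : XYQ r k' n => z.2.2) (𝓝 0) (𝓝 0) := continuous_snd.snd.tendsto _
  have ha0' := hq.eventually (ha.continuousAt.eventually_ne ha0)
  have hcrit : ∀ᶠ z in 𝓝 0, ∀ σ, z ∈ fiberCritical G σ ↔ Φ.toHomeo z ∈ fiberCritical F σ := by
    filter_upwards [hderiv, ha0', Φ.source_mem, hΦ.eventually_fst_apply_eq_zero_iff]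
      with z hderiv haz hz hfst σ
    simp only [mem_fiberCritical_iff, ← hΦ.1 z hz, hfst]
    refine and_congr_right fun hc => and_congr_right fun hσ => ?_
    rw [← hΦ.map_fiberDir hz hσ]
    simp only [Submodule.mem_map, forall_exists_index, and_imp, forall_apply_eq_imp_iff₂]
    refine forall₂_congr fun w hw => ?_
    have hq := (mem_fiberDir.1 hw).1
    rw [(hderiv hc w w hq hq).1, mul_eq_zero, or_iff_right haz]
    rfl
  refine MarkedGerm.ofStrata_equivOver Φ.tendsto Φ.symm.tendsto ?_ ?_ ?_
  · filter_upwards [hcrit, Φ.source_mem] with z hcrit hz σ hσ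
    exact ⟨(hcrit σ).1 hσ, Φ.toHomeo.left_inv hz, hψ z hz⟩
  · filter_upwards [Φ.symm.tendsto.eventually hcrit, Φ.symm.eventually_symm_apply]
      with y hcrit hy σ hσ
    exact ⟨(hcrit σ).2 (by rwa [← hy] at hσ), hy⟩
  · filter_upwards [hcrit, hderiv, ha0', Φ.source_mem] with z hcrit hderiv haz hz σ hzσ
    obtain ⟨hc, hσ, -⟩ := mem_fiberCritical_iff.1 hzσ
    refine degenerateOn_iff_of_map_eq (Φ.fderivEquiv hz).injective (hΦ.map_fiberDir hz hσ) haz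
      fun u hu w hw => ?_
    rw [(hderiv hc u w (mem_fiberDir.1 hu).1 (mem_fiberDir.1 hw).1).2,
      (mem_fiberCritical_iff.1 ((hcrit σ).1 hzσ)).2.2 _
        (hΦ.fderiv_fderiv_mem_fiberDir hz hσ hu hw), add_zero]
    rfl

end PCEquivalence

namespace SmoothGerm

variable {E F : Type} [NormedAddCommGroup E] [NormedSpace ℝ E] [NormedAddCommGroup F]
  [NormedSpace ℝ F] {f : E → F}

theorem contDiffAt (hf : SmoothGerm f) : ContDiffAt ℝ ∞ f 0 :=
  let ⟨_, hU, hfU⟩ := hf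
  hfU.contDiffAt hU

theorem eventually_contDiffAt (hf : SmoothGerm f) : ∀ᶠ x in 𝓝 0, ContDiffAt ℝ ∞ f x := by
  obtain ⟨U, hU, hfU⟩ := hf
  filter_upwards [eventually_mem_nhds_iff.2 hU] with x hx using hfU.contDiffAt hx

theorem exists_diffeoGerm_eq [CompleteSpace E] (hf : SmoothGerm f) (hf0 : f 0 = 0)
    (hinv : (fderiv ℝ f 0).IsInvertible) : ∃ g : DiffeoGerm E F, ⇑g.toHomeo = f := by
  obtain ⟨f', hf'⟩ := hinv
  have hderiv : HasFDerivAt f (f' : E →L[ℝ] F) 0 :=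
    hf' ▸ (hf.contDiffAt.differentiableAt (by simp)).hasFDerivAt
  have hopen : ∀ᶠ x in 𝓝 0, (fderiv ℝ f x).IsInvertible :=
    (hf.contDiffAt.fderiv_right (m := 0) (by simp)).continuousAt.eventually
      (ContinuousLinearEquiv.isOpen.mem_nhds ⟨f', hf'⟩)
  obtain ⟨U, hU, hUo, h0U⟩ := mem_nhds_iff.1 (hf.eventually_contDiffAt.and hopen)
  let e := (hf.contDiffAt.toOpenPartialHomeomorph f hderiv (by simp)).restrOpen U hUo
  have he0 : (0 : E) ∈ e.source :=
    ⟨hf.contDiffAt.mem_toOpenPartialHomeomorph_source hderiv (by simp), h0U⟩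
  refine ⟨⟨e, he0, hf0, fun x hx => (hU hx.2).1.contDiffWithinAt, fun y hy => ?_⟩, rfl⟩
  obtain ⟨hsmooth, L, hL⟩ := hU (e.map_target hy).2
  refine (e.contDiffAt_symm (f₀' := L) hy ?_ hsmooth).contDiffWithinAt
  exact hL ▸ (hsmooth.differentiableAt (by simp)).hasFDerivAt

theorem exists_leftInverse [FiniteDimensional ℝ E] [FiniteDimensional ℝ F] (hf : SmoothGerm f)
    (hf0 : f 0 = 0) (hinj : Function.Injective (fderiv ℝ f 0)) :
    ∃ ρ : F → E, ContDiffAt ℝ ∞ ρ 0 ∧ ρ 0 = 0 ∧ ∀ᶠ x in 𝓝 0, ρ (f x) = x := by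
  have := FiniteDimensional.complete ℝ E
  have h := ContinuousLinearMap.HasLeftInverse.of_injective_of_finiteDimensional hinj
  set K := h.leftInverse
  have hderiv : fderiv ℝ (K ∘ f) 0 = ContinuousLinearMap.id ℝ E := by
    rw [fderiv_comp _ K.differentiableAt (hf.contDiffAt.differentiableAt (by simp)), K.fderiv]
    exact ContinuousLinearMap.ext h.leftInverse_leftInverse
  obtain ⟨U, hU, hfU⟩ := hf
  obtain ⟨g, hg⟩ := exists_diffeoGerm_eq (f := K ∘ f) ⟨U, hU, K.contDiff.comp_contDiffOn hfU⟩
    (by simp [hf0]) ⟨.refl ℝ E, hderiv.symm⟩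
  refine ⟨g.symm.toHomeo ∘ K, ?_, ?_, ?_⟩
  · exact .comp 0 (by simpa only [map_zero] using g.symm.contDiffAt g.symm.zero_mem)
      K.contDiff.contDiffAt
  · simpa using g.symm.map_zero
  · filter_upwards [g.eventually_symm_apply] with x hx
    simpa [hg] using hx

end SmoothGerm

section Base

variable {r k k' n : ℕ}

theorem exists_diffeoGerm_eq_of_fibered {Φ : DiffeoGerm (XYQ r k n) (XYQ r k' n)}
    {ψ : (Fin n → ℝ) → (Fin n → ℝ)}
    (hψ : ∀ z ∈ Φ.toHomeo.source, (Φ.toHomeo z).2.2 = ψ z.2.2) :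
    ∃ g : DiffeoGerm (Fin n → ℝ) (Fin n → ℝ), ⇑g.toHomeo = ψ := by
  have hsmooth : SmoothGerm ψ := by
    have hincl : ContDiff ℝ ∞ fun q : Fin n → ℝ => ((0, 0, q) : XYQ r k n) := by fun_prop
    refine ⟨_, hincl.continuous.continuousAt.preimage_mem_nhds Φ.source_mem, ?_⟩
    exact (contDiff_snd.snd.comp_contDiffOn
      (Φ.smooth.comp hincl.contDiffOn fun _ hq => hq)).congr fun q hq => (hψ _ hq).symm
  have hψ0 : ψ 0 = 0 := by simpa [Φ.map_zero] using (hψ 0 Φ.zero_mem).symm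
  have hsurj : Function.Surjective (fderiv ℝ ψ 0) := by
    have hΦ := (Φ.differentiableAt Φ.zero_mem).hasFDerivAt.snd.snd
    have hq := (hasFDerivAt_id (𝕜 := ℝ) (0 : XYQ r k n)).snd.snd
    have hcomp := (hsmooth.contDiffAt.differentiableAt (by simp)).hasFDerivAt.comp 0 hq
    have heq := hΦ.unique (hcomp.congr_of_eventuallyEq (Filter.mem_of_superset Φ.source_mem hψ))
    intro v
    obtain ⟨w, hw⟩ := (Φ.fderivEquiv Φ.zero_mem).surjective (0, 0, v)
    exact ⟨w.2.2, (DFunLike.congr_fun heq w).symm.trans (congrArg (·.2.2) hw)⟩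
  have hinj : Function.Injective (fderiv ℝ ψ 0) :=
    (fderiv ℝ ψ 0).toLinearMap.injective_iff_surjective.2 hsurj
  exact hsmooth.exists_diffeoGerm_eq hψ0
    ⟨(LinearEquiv.ofBijective (fderiv ℝ ψ 0).toLinearMap ⟨hinj, hsurj⟩).toContinuousLinearEquiv,
      rfl⟩

theorem PCEquivalent.exists_fiberGerm_equivOver {F : XYQ r k n → ℝ} {G : XYQ r k' n → ℝ}
    (hF : ContDiffAt ℝ 2 F 0) (hG : ContDiffAt ℝ 2 G 0) (h : PCEquivalent F G) :
    ∃ g : DiffeoGerm (Fin n → ℝ) (Fin n → ℝ),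
      (fiberGerm F).EquivOver (fiberGerm G) g.toHomeo := by
  obtain ⟨Φ, a, b, hΦ, ha, ha0, hb, hGF⟩ := h
  obtain ⟨ψ, hψ⟩ := hΦ.2.2
  obtain ⟨g, rfl⟩ := exists_diffeoGerm_eq_of_fibered hψ
  have H := fiberGerm_equivOver_of_eq_mul_comp_add hΦ hψ (contDiffAt_infty.1 ha.contDiffAt 2) ha0
    (contDiffAt_infty.1 hb.contDiffAt 2) hF hG hGF
  have hq : Tendsto (fun z : XYQ r k' n => z.2.2) (𝓝 0) (𝓝 0) := continuous_snd.snd.tendsto _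
  exact ⟨g.symm, H.symm (hq.eventually g.eventually_symm_apply)⟩

end Base

/-! ### Generating families and Lagrangian maps -/

section ToCotangent

variable {r k n : ℕ} {F : XYQ r k n → ℝ} {σ : Finset (Fin r)} {z : XYQ r k n}

/-- The map `(x, y, q) ↦ (q, ∂F/∂q)` to the cotangent bundle. -/
noncomputable def toCotangent (F : XYQ r k n → ℝ) (z : XYQ r k n) : Cotangent n :=
  (z.2.2, dQ F z)

/-- The common kernel of the differentials at `z` of the equations `x_σ = 0`,
`∂F/∂x_{I_r - σ} = 0`, `∂F/∂y = 0` of the fiberwise critical points. -/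
def criticalTangent (F : XYQ r k n → ℝ) (σ : Finset (Fin r)) (z : XYQ r k n) :
    Set (XYQ r k n) :=
  {u | (∀ i ∈ σ, u.1 i = 0) ∧ ∀ w ∈ fiberDir r k n σ, fderiv ℝ (fderiv ℝ F) z u w = 0}

theorem mem_degeneratePoints_iff :
    z ∈ degeneratePoints F σ ↔ ∃ u ∈ criticalTangent F σ z, u ≠ 0 ∧ u.2.2 = 0 := by
  refine exists_congr fun u => ?_
  rw [mem_fiberDir]
  simp only [criticalTangent, mem_ofPred_eq]
  tauto

theorem hasFDerivAt_toCotangent (hF : ContDiffAt ℝ 2 F z) :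
    HasFDerivAt (toCotangent F)
      ((ContinuousLinearMap.snd ℝ _ _ ∘L ContinuousLinearMap.snd ℝ _ _).prod
        (.pi fun l => (fderiv ℝ (fderiv ℝ F) z).flip (0, 0, Pi.single l 1))) z :=
  (hasFDerivAt_snd.comp z hasFDerivAt_snd).prodMk
    (hasFDerivAt_pi.2 fun _ => hasFDerivAt_fderiv_apply hF _)

theorem fderiv_toCotangent_apply (hF : ContDiffAt ℝ 2 F z) (u : XYQ r k n) :
    fderiv ℝ (toCotangent F) z u =
      (u.2.2, fun l => fderiv ℝ (fderiv ℝ F) z u (0, 0, Pi.single l 1)) := by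
  rw [(hasFDerivAt_toCotangent hF).fderiv]
  rfl

theorem fderiv_fderiv_apply_of_mem_criticalTangent {u v : XYQ r k n}
    (hu : u ∈ criticalTangent F σ z) (hv : ∀ i ∈ σ, v.1 i = 0) :
    fderiv ℝ (fderiv ℝ F) z u v =
      ∑ l, v.2.2 l * fderiv ℝ (fderiv ℝ F) z u (0, 0, Pi.single l 1) := by
  have hsplit : v = (v.1, v.2.1, 0) + (0, 0, v.2.2) := by ext <;> simp
  have hfiber : ((v.1, v.2.1, 0) : XYQ r k n) ∈ fiberDir r k n σ := mem_fiberDir.2 ⟨rfl, hv⟩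
  conv_lhs => rw [hsplit, map_add, hu.2 _ hfiber, zero_add, apply_eq_sum_single]
  simp

theorem canonicalForm_fderiv_toCotangent_eq_zero (hF : ContDiffAt ℝ 2 F z) {u v : XYQ r k n}
    (hu : u ∈ criticalTangent F σ z) (hv : v ∈ criticalTangent F σ z) :
    canonicalForm (fderiv ℝ (toCotangent F) z u) (fderiv ℝ (toCotangent F) z v) = 0 := by
  have hsymm := (hF.isSymmSndFDerivAt (by simp)).eq v u
  rw [fderiv_fderiv_apply_of_mem_criticalTangent hv hu.1,
    fderiv_fderiv_apply_of_mem_criticalTangent hu hv.1] at hsymm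
  simp only [fderiv_toCotangent_apply hF, canonicalForm, Finset.sum_sub_distrib, hsymm]
  exact sub_eq_zero.2 (Finset.sum_congr rfl fun l _ => mul_comm _ _)

theorem fderiv_apply_mem_criticalTangent {E : Type*} [NormedAddCommGroup E] [NormedSpace ℝ E]
    {A : E → XYQ r k n} {s : Set E} {x v : E} (hx : x ∈ s) (hA : DifferentiableAt ℝ A x)
    (hF : ContDiffAt ℝ 2 F (A x)) (hcrit : ∀ᶠ x' in 𝓝[s] x, A x' ∈ fiberCritical F σ)
    (hv : v ∈ Submodule.span ℝ (tangentConeAt ℝ s x)) :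
    fderiv ℝ A x v ∈ criticalTangent F σ (A x) := by
  have hvanish : ∀ {f : XYQ r k n → ℝ} {f' : XYQ r k n →L[ℝ] ℝ}, HasFDerivAt f f' (A x) →
      (∀ z ∈ fiberCritical F σ, f z = 0) → f' (fderiv ℝ A x v) = 0 := by
    intro f f' hf h
    have hfA := hf.comp x hA.hasFDerivAt
    have hzero : f ∘ A =ᶠ[𝓝[s] x] fun _ => 0 := hcrit.mono fun x' hx' => h _ hx'
    simpa [hfA.fderiv] using fderiv_apply_eq_of_mem_span_tangentConeAt hx hfA.differentiableAt
      (differentiableAt_const 0) hzero hv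
  exact ⟨fun i hi => hvanish (hasFDerivAt_pi'.1 (hasFDerivAt_id (A x)).fst i)
      fun z hz => hz.2.1 i hi,
    fun w hw => hvanish (hasFDerivAt_fderiv_apply hF w)
      fun z hz => (mem_fiberCritical_iff.1 hz).2.2 w hw⟩

end ToCotangent

section Immersion

variable {r k n : ℕ} {F : XYQ r k n → ℝ}

theorem SNondegenerate.eq_zero (hN : SNondegenerate F) (hF : ContDiffAt ℝ 2 F 0)
    {u : XYQ r k n} (hq : u.2.2 = 0)
    (hu : ∀ w : XYQ r k n, w.1 = 0 → fderiv ℝ (fderiv ℝ F) 0 u w = 0) : u = 0 := by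
  set B := fderiv ℝ (fderiv ℝ F) 0
  have hfst : ∀ w, B u w = ∑ i, w.1 i * B u (Pi.single i 1, 0, 0) := fun w => by
    rw [apply_eq_sum_single]
    simp [hu (0, _, _) rfl]
  have hsnd : ∀ w, B w u =
      ∑ i, u.1 i * B w (Pi.single i 1, 0, 0) + ∑ j, u.2.1 j * B w (0, Pi.single j 1, 0) :=
    fun w => by
      rw [apply_eq_sum_single (B w) u]
      simp [hq]
  have hsymm : ∀ w, B u w = B w u := (hF.isSymmSndFDerivAt (by simp)).eq u
  have hcoord : ∀ (i : Fin r) (w : XYQ r k n),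
      fderiv ℝ (fun z : XYQ r k n => z.1 i) 0 w = w.1 i := fun i w =>
    DFunLike.congr_fun
      (hasFDerivAt_pi'.1 (hasFDerivAt_fst (𝕜 := ℝ) (p := (0 : XYQ r k n))) i).fderiv w
  have hdX : ∀ i w, fderiv ℝ (dX F i) 0 w = B w (Pi.single i 1, 0, 0) := fun i w =>
    DFunLike.congr_fun (hasFDerivAt_fderiv_apply hF _).fderiv w
  have hdY : ∀ j w, fderiv ℝ (dY F j) 0 w = B w (0, Pi.single j 1, 0) := fun j w =>
    DFunLike.congr_fun (hasFDerivAt_fderiv_apply hF _).fderiv w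
  -- By symmetry of the second derivative, `B u` is a combination of the `dx_i` and also of the
  -- differentials of `∂F/∂x_i` and `∂F/∂y_j`; the difference is a linear relation.
  have hcoeff := Fintype.linearIndependent_iff.1 hN
    (Sum.elim (fun i => -B u (Pi.single i 1, 0, 0)) (Sum.elim u.1 u.2.1)) <| by
      refine ContinuousLinearMap.ext fun w => ?_
      have hrel : -B u w + B w u = 0 := by rw [hsymm, neg_add_cancel]
      rw [hfst, hsnd] at hrel
      simpa [Fintype.sum_sum_type, hcoord, hdX, hdY, mul_comm] using hrel
  exact Prod.ext (funext fun i => hcoeff (.inr (.inl i)))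
    (Prod.ext (funext fun j => hcoeff (.inr (.inr j))) hq)

/-- The map `(x, y, q) ↦ (q, ∂F/∂q, ∂F/∂y)`, which is an immersion at `0` for an
`S`-non-degenerate `F`. -/
noncomputable def toCotangentY (F : XYQ r k n → ℝ) (z : XYQ r k n) :
    Cotangent n × (Fin k → ℝ) :=
  (toCotangent F z, fun j => dY F j z)

theorem fderiv_toCotangentY_apply {z : XYQ r k n} (hF : ContDiffAt ℝ 2 F z) (u : XYQ r k n) :
    fderiv ℝ (toCotangentY F) z u = (fderiv ℝ (toCotangent F) z u,
      fun j => fderiv ℝ (fderiv ℝ F) z u (0, Pi.single j 1, 0)) := by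
  have h := (hasFDerivAt_toCotangent hF).differentiableAt.hasFDerivAt.prodMk
    (hasFDerivAt_pi.2 fun j => hasFDerivAt_fderiv_apply hF (0, Pi.single j 1, 0))
  exact DFunLike.congr_fun h.fderiv u

theorem smoothGerm_toCotangentY (hF : SmoothGerm F) : SmoothGerm (toCotangentY F) := by
  obtain ⟨U, hU, hFU⟩ := hF
  have hderiv : ContDiffOn ℝ ∞ (fderiv ℝ F) (interior U) :=
    (hFU.mono interior_subset).fderiv_of_isOpen isOpen_interior (by simp)
  have hpartial : ∀ w, ContDiffOn ℝ ∞ (fun z => fderiv ℝ F z w) (interior U) := fun _ =>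
    hderiv.clm_apply contDiffOn_const
  exact ⟨_, interior_mem_nhds.2 hU,
    (contDiff_snd.snd.contDiffOn.prodMk (contDiffOn_pi.2 fun _ => hpartial _)).prodMk
      (contDiffOn_pi.2 fun _ => hpartial _)⟩

theorem SNondegenerate.injective_fderiv_toCotangentY (hN : SNondegenerate F)
    (hF : ContDiffAt ℝ 2 F 0) : Function.Injective (fderiv ℝ (toCotangentY F) 0) := by
  refine (injective_iff_map_eq_zero _).2 fun u hu => ?_
  simp only [fderiv_toCotangentY_apply hF, fderiv_toCotangent_apply hF, Prod.mk_eq_zero,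
    funext_iff, Pi.zero_apply] at hu
  obtain ⟨⟨hq, hdQ⟩, hdY⟩ := hu
  refine hN.eq_zero hF (funext hq) fun w hw => ?_
  rw [apply_eq_sum_single]
  simp [hw, hdQ, hdY]

theorem exists_leftInverse_toCotangent (hF : SmoothGerm F) (hF0 : fderiv ℝ F 0 = 0)
    (hN : SNondegenerate F) :
    ∃ ρ : Cotangent n → XYQ r k n, ContDiffAt ℝ ∞ ρ 0 ∧ ρ 0 = 0 ∧
      ∀ᶠ z in 𝓝 0, (∀ j, dY F j z = 0) → ρ (toCotangent F z) = z := by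
  have hzero : toCotangentY F 0 = 0 := by
    ext <;> simp [toCotangentY, toCotangent, dQ, dY, hF0]
  obtain ⟨ρ, hρ, hρ0, hleft⟩ := (smoothGerm_toCotangentY hF).exists_leftInverse hzero
    (hN.injective_fderiv_toCotangentY (contDiffAt_infty.1 hF.contDiffAt 2))
  refine ⟨fun c => ρ (c, 0), ?_, hρ0, ?_⟩
  · exact ContDiffAt.comp (g := ρ) (0 : Cotangent n) hρ (contDiffAt_id.prodMk contDiffAt_const)
  · filter_upwards [hleft] with z hz hdY
    rwa [toCotangentY, funext hdY] at hz

theorem eventually_eq_zero_of_fderiv_toCotangent_eq_zero (hF : SmoothGerm F)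
    (hN : SNondegenerate F) :
    ∀ᶠ z in 𝓝 0, ∀ σ, ∀ u ∈ criticalTangent F σ z, fderiv ℝ (toCotangent F) z u = 0 → u = 0 := by
  have hopen : ∀ᶠ z in 𝓝 0, Function.Injective (fderiv ℝ (toCotangentY F) z) :=
    ((smoothGerm_toCotangentY hF).contDiffAt.fderiv_right (m := 0)
      (by simp)).continuousAt.eventually (ContinuousLinearMap.isOpen_injective.mem_nhds
        (hN.injective_fderiv_toCotangentY (contDiffAt_infty.1 hF.contDiffAt 2)))
  filter_upwards [hopen, hF.eventually_contDiffAt] with z hinj hFz σ u hu huz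
  refine (injective_iff_map_eq_zero _).1 hinj u ?_
  rw [fderiv_toCotangentY_apply (contDiffAt_infty.1 hFz 2), huz]
  exact Prod.ext rfl (funext (forall_mem_fiberDir_apply_eq_zero_iff.1 hu.2).2)

end Immersion

section TangentL

variable {r n : ℕ} {hrn : r ≤ n} {σ : Finset (Fin r)}

theorem mem_tangentL_of_forall_canonicalForm_eq_zero {v : Cotangent n}
    (hv : ∀ w ∈ tangentL hrn σ, canonicalForm v w = 0) : v ∈ tangentL hrn σ := by
  have hfst : ∀ j, (0, Pi.single j 1) ∈ tangentL hrn σ → v.1 j = 0 := fun j hj => by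
    simpa [canonicalForm, Pi.single_apply] using hv _ hj
  have hsnd : ∀ j, (Pi.single j 1, 0) ∈ tangentL hrn σ → v.2 j = 0 := fun j hj => by
    simpa [canonicalForm, Pi.single_apply] using hv _ hj
  refine ⟨fun i hi => hfst _ ⟨fun _ _ => rfl, fun i' hi' => ?_, fun _ _ => rfl⟩,
    fun i hi => hsnd _ ⟨fun i' hi' => ?_, fun _ _ => rfl, fun j hj => ?_⟩,
    fun j hj => hfst _ ⟨fun _ _ => rfl, fun i' _ => ?_, fun _ _ => rfl⟩⟩
  · exact Pi.single_eq_of_ne (fun h => hi' (by rwa [Fin.castLE_injective hrn h])) _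
  · exact Pi.single_eq_of_ne (fun h => hi (by rwa [← Fin.castLE_injective hrn h])) _
  · exact Pi.single_eq_of_ne (fun h => by simp [h] at hj; omega) _
  · exact Pi.single_eq_of_ne (fun h => by simp [← h] at hj; omega) _

theorem add_mem_stdL {z v : Cotangent n} (hz : z ∈ stdL hrn σ) (hv : v ∈ stdL hrn σ) :
    z + v ∈ stdL hrn σ := by
  obtain ⟨⟨hz₁, hz₂, hz₃⟩, hz₄⟩ := hz
  obtain ⟨⟨hv₁, hv₂, hv₃⟩, hv₄⟩ := hv
  exact ⟨⟨fun i hi => by simp [hz₁ i hi, hv₁ i hi], fun i hi => by simp [hz₂ i hi, hv₂ i hi],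
    fun j hj => by simp [hz₃ j hj, hv₃ j hj]⟩, fun i hi => add_nonneg (hz₄ i hi) (hv₄ i hi)⟩

theorem smul_mem_stdL {v : Cotangent n} (hv : v ∈ stdL hrn σ) {t : ℝ} (ht : 0 ≤ t) :
    t • v ∈ stdL hrn σ := by
  obtain ⟨⟨hv₁, hv₂, hv₃⟩, hv₄⟩ := hv
  exact ⟨⟨fun i hi => by simp [hv₁ i hi], fun i hi => by simp [hv₂ i hi],
    fun j hj => by simp [hv₃ j hj]⟩, fun i hi => mul_nonneg ht (hv₄ i hi)⟩

theorem mem_span_tangentConeAt_stdL {z v : Cotangent n} (hz : z ∈ stdL hrn σ)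
    (hv : v ∈ tangentL hrn σ) : v ∈ Submodule.span ℝ (tangentConeAt ℝ (stdL hrn σ) z) := by
  have hcone : ∀ w ∈ stdL hrn σ, w ∈ tangentConeAt ℝ (stdL hrn σ) z := fun w hw => by
    have hsegment : segment ℝ z (z + w) ⊆ stdL hrn σ := by
      rw [segment_eq_image']
      rintro _ ⟨t, ht, rfl⟩
      simpa using add_mem_stdL hz (smul_mem_stdL hw ht.1)
    simpa using mem_tangentConeAt_of_segment_subset hsegment
  have hpos : (v.1⁺, v.2) ∈ stdL hrn σ :=
    ⟨⟨fun i hi => by simp [hv.1 i hi], hv.2.1, fun j hj => by simp [hv.2.2 j hj]⟩,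
      fun i _ => posPart_nonneg (v.1 (Fin.castLE hrn i))⟩
  have hneg : (v.1⁻, 0) ∈ stdL hrn σ :=
    ⟨⟨fun i hi => by simp [hv.1 i hi], fun _ _ => rfl, fun j hj => by simp [hv.2.2 j hj]⟩,
      fun i _ => negPart_nonneg (v.1 (Fin.castLE hrn i))⟩
  have hsub : v = (v.1⁺, v.2) - (v.1⁻, 0) := by ext <;> simp
  rw [hsub]
  exact sub_mem (Submodule.subset_span (hcone _ hpos)) (Submodule.subset_span (hcone _ hneg))

end TangentL

section GeneratingFamily

variable {r k n : ℕ} {hrn : r ≤ n} {S : SymplecticGerm n} {F : XYQ r k n → ℝ}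

theorem fderiv_symm_mem_tangentL {σ : Finset (Fin r)} {z c : Cotangent n}
    (hz : z ∈ S.toHomeo.source)
    (hc : ∀ w ∈ tangentL hrn σ, canonicalForm c (fderiv ℝ S.toHomeo z w) = 0) :
    (S.fderivEquiv hz).symm c ∈ tangentL hrn σ := by
  refine mem_tangentL_of_forall_canonicalForm_eq_zero fun w hw => ?_
  rw [← S.symplectic z hz, ← hc w hw]
  exact congrArg (canonicalForm · _) ((S.fderivEquiv hz).apply_symm_apply c)

theorem mem_singularPoints_iff {A : Cotangent n → XYQ r k n} {σ : Finset (Fin r)}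
    {z : Cotangent n} (hz : z ∈ stdL hrn σ) (hzS : z ∈ S.toHomeo.source)
    (hA : DifferentiableAt ℝ A z) (hF : ContDiffAt ℝ 2 F (A z))
    (hcrit : ∀ᶠ z' in 𝓝[stdL hrn σ] z, A z' ∈ fiberCritical F σ)
    (hlift : toCotangent F ∘ A =ᶠ[𝓝[stdL hrn σ] z] S.toHomeo)
    (hinj : ∀ u ∈ criticalTangent F σ (A z), fderiv ℝ (toCotangent F) (A z) u = 0 → u = 0) :
    z ∈ singularPoints hrn S.toHomeo σ ↔ A z ∈ degeneratePoints F σ := by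
  have hjF := hasFDerivAt_toCotangent hF
  have hproj : ∀ u, (fderiv ℝ (toCotangent F) (A z) u).1 = u.2.2 := fun u => by
    rw [fderiv_toCotangent_apply hF]
  have hdA : ∀ v ∈ tangentL hrn σ, fderiv ℝ A z v ∈ criticalTangent F σ (A z) := fun v hv =>
    fderiv_apply_mem_criticalTangent hz hA hF hcrit (mem_span_tangentConeAt_stdL hz hv)
  have hdlift : ∀ v ∈ tangentL hrn σ,
      fderiv ℝ (toCotangent F) (A z) (fderiv ℝ A z v) = fderiv ℝ S.toHomeo z v := fun v hv => by
    rw [← fderiv_apply_eq_of_mem_span_tangentConeAt hz (hjF.comp z hA.hasFDerivAt).differentiableAt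
      (S.differentiableAt hzS) hlift (mem_span_tangentConeAt_stdL hz hv),
      fderiv_comp z hjF.differentiableAt hA]
    rfl
  rw [mem_degeneratePoints_iff]
  constructor
  · rintro ⟨v, hv, hv0, hSv⟩
    refine ⟨_, hdA v hv, fun h => hv0 ((S.fderivEquiv hzS).map_eq_zero_iff.1 ?_), ?_⟩
    · exact (hdlift v hv).symm.trans (by rw [h, map_zero])
    · rw [← hproj, hdlift v hv, hSv]
  · rintro ⟨u, hu, hu0, hq⟩
    -- The image of the critical tangent space is isotropic and contains the Lagrangian subspace
    -- `dS(T L_σ⁰)`, hence is equal to it.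
    have hmem := fderiv_symm_mem_tangentL (hrn := hrn) (σ := σ) hzS
      (c := fderiv ℝ (toCotangent F) (A z) u) fun w hw => by
        rw [← hdlift w hw]
        exact canonicalForm_fderiv_toCotangent_eq_zero hF hu (hdA w hw)
    refine ⟨_, hmem, fun h => hu0 (hinj u hu ((S.fderivEquiv hzS).symm.map_eq_zero_iff.1 h)), ?_⟩
    rw [← S.coe_fderivEquiv hzS, ContinuousLinearEquiv.coe_coe,
      ContinuousLinearEquiv.apply_symm_apply, hproj, hq]

theorem tendsto_toCotangent (hF : SmoothGerm F) (hF0 : fderiv ℝ F 0 = 0) :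
    Tendsto (toCotangent F) (𝓝 0) (𝓝 0) := by
  have hzero : toCotangent F 0 = 0 := by ext <;> simp [toCotangent, dQ, hF0]
  simpa only [ContinuousAt, hzero] using
    (hasFDerivAt_toCotangent (contDiffAt_infty.1 hF.contDiffAt 2)).continuousAt

namespace IsGeneratingFamily

theorem exists_eventually_mem_image_iff (h : IsGeneratingFamily hrn S F) {V : Set (XYQ r k n)}
    (hV : V ∈ 𝓝 0) :
    ∃ W ∈ 𝓝 0, W ⊆ V ∧ ∀ᶠ c in 𝓝 0, ∀ σ, c ∈ S.toHomeo '' (stdL hrn σ ∩ S.toHomeo.source) ↔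
      c ∈ toCotangent F '' (fiberCritical F σ ∩ W) := by
  obtain ⟨-, -, -, -, U, hU, hgen⟩ := h
  exact ⟨V ∩ U, inter_mem hV hU, inter_subset_left,
    eventually_all.2 fun σ => (hgen _ (inter_mem hV hU) inter_subset_right σ).mem_iff⟩

theorem exists_lift (h : IsGeneratingFamily hrn S F) :
    ∃ A : Cotangent n → XYQ r k n, ContDiffAt ℝ ∞ A 0 ∧ A 0 = 0 ∧
      (∀ᶠ z in 𝓝 0, ∀ σ, z ∈ stdL hrn σ →
        A z ∈ fiberCritical F σ ∧ toCotangent F (A z) = S.toHomeo z) ∧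
      ∀ᶠ ζ in 𝓝 0, ∀ σ, ζ ∈ fiberCritical F σ →
        S.symm.toHomeo (toCotangent F ζ) ∈ stdL hrn σ ∧
          A (S.symm.toHomeo (toCotangent F ζ)) = ζ := by
  have ⟨hF, _, hF0, hN, _⟩ := h
  obtain ⟨ρ, hρ, hρ0, hleft⟩ := exists_leftInverse_toCotangent hF hF0 hN
  obtain ⟨W, hW, hWleft, hset⟩ := h.exists_eventually_mem_image_iff hleft
  refine ⟨ρ ∘ S.toHomeo, ?_, by simp [S.map_zero, hρ0], ?_, ?_⟩
  · exact ContDiffAt.comp 0 (by rwa [S.map_zero]) (S.contDiffAt S.zero_mem)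
  · filter_upwards [S.source_mem, S.tendsto.eventually hset] with z hzS hz σ hzσ
    obtain ⟨ζ, ⟨hζ, hζW⟩, hζz⟩ := (hz σ).1 ⟨z, ⟨hzσ, hzS⟩, rfl⟩
    have hρz : ρ (S.toHomeo z) = ζ := by rw [← hζz, hWleft hζW hζ.2.2.2]
    exact ⟨by rwa [Function.comp_apply, hρz], by rw [Function.comp_apply, hρz, hζz]⟩
  · filter_upwards [hW, (tendsto_toCotangent hF hF0).eventually hset] with ζ hζW hζ σ hζσ
    obtain ⟨z, ⟨hz, hzS⟩, hzζ⟩ := (hζ σ).2 ⟨ζ, ⟨hζσ, hζW⟩, rfl⟩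
    have hsymm : S.symm.toHomeo (toCotangent F ζ) = z := by
      rw [← hzζ]
      exact S.toHomeo.left_inv hzS
    exact ⟨by rwa [hsymm], by rw [hsymm, Function.comp_apply, hzζ, hWleft hζW hζσ.2.2.2]⟩

theorem equivOver (h : IsGeneratingFamily hrn S F) :
    (lagrangianGerm hrn S).EquivOver (fiberGerm F) id := by
  have ⟨hF, _, hF0, hN, _⟩ := h
  obtain ⟨A, hA, hA0, hforward, hbackward⟩ := h.exists_lift
  have htendsto : Tendsto A (𝓝 0) (𝓝 0) := by simpa only [ContinuousAt, hA0] using hA.continuousAt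
  have htendsto_inv : Tendsto (S.symm.toHomeo ∘ toCotangent F) (𝓝 0) (𝓝 0) :=
    S.symm.tendsto.comp (tendsto_toCotangent hF hF0)
  refine MarkedGerm.ofStrata_equivOver htendsto htendsto_inv ?_ hbackward ?_
  · filter_upwards [hforward, S.eventually_symm_apply] with z hz hSz σ hzσ
    obtain ⟨hcrit, hlift⟩ := hz σ hzσ
    exact ⟨hcrit, by rw [Function.comp_apply, hlift, hSz], congrArg Prod.fst hlift⟩
  · have hdiff : ∀ᶠ z in 𝓝 0, ContDiffAt ℝ 1 A z :=
      (hA.of_le (by simp)).eventually (by simp)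
    have hF2 := htendsto.eventually hF.eventually_contDiffAt
    have hinj := htendsto.eventually (eventually_eq_zero_of_fderiv_toCotangent_eq_zero hF hN)
    filter_upwards [S.source_mem, hforward.eventually_nhds, hdiff, hF2, hinj]
      with z hzS hz hAz hFz hinjz σ hzσ
    have hstratum := eventually_nhdsWithin_iff.2 (hz.mono fun _ hz' => hz' σ)
    exact mem_singularPoints_iff hzσ hzS (hAz.differentiableAt (by simp))
      (contDiffAt_infty.1 hFz 2) (hstratum.mono fun _ hz' => hz'.1)
      (hstratum.mono fun _ hz' => hz'.2) (hinjz σ)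

end IsGeneratingFamily

end GeneratingFamily

theorem proposition2p4 {r n k₁ k₂ : ℕ} (hrn : r ≤ n) (S₁ S₂ : SymplecticGerm n)
    (F₁ : XYQ r k₁ n → ℝ) (F₂ : XYQ r k₂ n → ℝ)
    (h₁ : IsGeneratingFamily hrn S₁ F₁) (h₂ : IsGeneratingFamily hrn S₂ F₂)
    (h : StablyPCEquivalent F₁ F₂) :
    CausticEquivalent hrn S₁ S₂ := by
  obtain ⟨l, l', Q, Q', hQ, hQ', hPC⟩ := h
  have hF₁ : ContDiffAt ℝ 2 F₁ 0 := contDiffAt_infty.1 h₁.1.contDiffAt 2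
  have hF₂ : ContDiffAt ℝ 2 F₂ 0 := contDiffAt_infty.1 h₂.1.contDiffAt 2
  obtain ⟨g, hg⟩ := hPC.exists_fiberGerm_equivOver (contDiffAt_addQuadratic hF₁ Q)
    (contDiffAt_addQuadratic hF₂ Q')
  have hstable₁ : (lagrangianGerm hrn S₁).EquivOver (fiberGerm (addQuadratic F₁ Q)) id :=
    h₁.equivOver.trans (fiberGerm_equivOver_addQuadratic hF₁ hQ)
  have hstable₂ : (fiberGerm (addQuadratic F₂ Q')).EquivOver (lagrangianGerm hrn S₂) id :=
    (h₂.equivOver.trans (fiberGerm_equivOver_addQuadratic hF₂ hQ')).symm (.of_forall fun _ => rfl)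
  exact .of_equivOver g ((hstable₁.trans hg).trans hstable₂)
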